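/- **Lemma (inverse generalized Marini formula).** *Setting.* Let $d\ge 1$ and let $\Omega\subseteq\mathbb{R}^d$ be a bounded simplicial Lipschitz domain with a conforming triangulation $\mathcal{T}_h$ into finitely many closed $d$-simplices. Let $\mathcal{S}_h^{i}$ be the set of interior sides (common $(d-1)$-dimensional faces of two elements) and $\mathcal{S}_h^{\partial}$ the set of boundary sides ($(d-1)$-dimensional faces of elements contained in $\partial\Omega$). Let $\partial\Omega=\overline{\Gamma}_I\cup\overline{\Gamma}_D\cup\overline{\Gamma}_N$ with disjoint relatively open $\Gamma_I\neq\emptyset$, $\Gamma_D$, $\Gamma_N\subseteq\partial\Omega$ such that $\mathcal{S}_h^{\partial}=\mathcal{S}_h^{I}\,\dot\cup\,\mathcal{S}_h^{D}\,\dot\cup\,\mathcal{S}_h^{N}$, where $\mathcal{S}_h^{X}$ consists of the boundary sides with relative interior contained in $\Gamma_X$. *Spaces.* Let $\mathcal{L}^k(\mathcal{T}_h)$ be the space of element-wise polynomial functions of degree at most $k$ and $\mathcal{L}^0(\mathcal{S}_h^X)$ the space of side-wise constant functions on $\Gamma_X$. Let $\Pi_h$ and $\pi_h$ denote the element-wise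 and side-wise mean values, $\nabla_h$ the element-wise gradient, $(\cdot,\cdot)_\omega$ the $L^2$-inner product on $\omega$, $n$ the outward unit normal on $\partial \Omega$, and $n_T$ the outward unit normal on $\partial T$. Set $$\mathcal{S}^{1,cr}(\mathcal{T}_h)=\{v_h\in\mathcal{L}^1(\mathcal{T}_h) : \text{the jump of } v_h \text{ across } S \text{ has mean value } 0 \text{ for every } S\in\mathcal{S}_h^i\},$$ let $\mathcal{R}T^0(\mathcal{T}_h)$ be the space of all $y_h\in(\mathcal{L}^1(\mathcal{T}_h))^d$ such that $y_h|_T\cdot n_T$ is constant on each side of each $T\in\mathcal{T}_h$ and $y_h|_{T_+}\cdot n_{T_+}+y_h|_{T_-}\cdot n_{T_-}=0$ on each interior side $S=T_+\cap T_-$, and let $\mathcal{R}T^0_N(\mathcal{T}_h)=\{y_h\in\mathcal{R}T^0(\mathcal{T}_h) : y_h\cdot n=0\text{ on }\Gamma_N\}$. *Discrete primal problem.* Let $m>0$, $f_h\in\mathcal{L}^0(\mathcal{T}_h)$, $g_h\in\mathcal{L}^0(\mathcal{S}_h^N)$, $u_D^h\in\mathcal{L}^0(\mathcal{S}_h^D)$.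 For $v_h\in\mathcal{S}^{1,cr}(\mathcal{T}_h)$ put $$I_h^{cr}(v_h)=\tfrac12\|\nabla_h v_h\|_{L^2(\Omega)}^2+\tfrac1{2m}\|\pi_h v_h\|_{L^1(\Gamma_I)}^2-(f_h,\Pi_h v_h)_\Omega-(g_h,\pi_h v_h)_{\Gamma_N}$$ if $\pi_h v_h=u_D^h$ on $\Gamma_D$, and $I_h^{cr}(v_h)=+\infty$ otherwise. A *discrete primal solution* is a minimizer of $I_h^{cr}$ over $\mathcal{S}^{1,cr}(\mathcal{T}_h)$ at which $I_h^{cr}$ is finite. *Claim.* Let $(z_h^{rt},\overline{u}_h,\mu_h,\lambda_h^+,\lambda_h^-)\in\mathcal{R}T^0(\mathcal{T}_h)\times\mathcal{L}^0(\mathcal{T}_h)\times\mathbb{R}\times(\mathcal{L}^0(\mathcal{S}_h^I))^2$ satisfy the KKT system of the augmented discrete dual problem, that is, $z_h^{rt}\cdot n=g_h$ on $\Gamma_N$ and, for all $(y_h,\overline{v}_h,\eta_h)\in\mathcal{R}T^0_N(\mathcal{T}_h)\times\mathcal{L}^0(\mathcal{T}_h)\times\mathbb{R}$, $$(\Pi_h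 z_h^{rt},\Pi_h y_h)_\Omega+(\overline{u}_h,\operatorname{div}y_h)_\Omega+(\lambda_h^+-\lambda_h^-,y_h\cdot n)_{\Gamma_I}=(u_D^h,y_h\cdot n)_{\Gamma_D},$$ $$(\operatorname{div}z_h^{rt},\overline{v}_h)_\Omega=-(f_h,\overline{v}_h)_\Omega,\qquad m\mu_h\eta_h+(\lambda_h^++\lambda_h^-,\eta_h)_{\Gamma_I}=0,$$ $$\mu_h\pm z_h^{rt}\cdot n\ge0,\qquad \lambda_h^{\pm}(\mu_h\pm z_h^{rt}\cdot n)=0,\qquad \lambda_h^{\pm}\le0\qquad\text{on }\Gamma_I.$$ Then the function $$u_h^{cr}=\overline{u}_h+\Pi_h z_h^{rt}\cdot(\mathrm{id}_{\mathbb{R}^d}-\Pi_h\mathrm{id}_{\mathbb{R}^d})\in\mathcal{L}^1(\mathcal{T}_h)$$ belongs to $\mathcal{S}^{1,cr}(\mathcal{T}_h)$ and is a discrete primal solution. -/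

import Mathlib

open MeasureTheory
open scoped RealInnerProductSpace

noncomputable section

namespace OptimalInsulation

/-- The Euclidean space `ℝ^d`. -/
abbrev Pt (d : ℕ) : Type := EuclideanSpace ℝ (Fin d)

/-- The closed simplex spanned by a finite set of vertices. -/
def hull {d : ℕ} (S : Finset (Pt d)) : Set (Pt d) := convexHull ℝ (S : Set (Pt d))

/-- A (conforming) triangulation in `ℝ^d`: finitely many non-degenerate `d`-simplices, each given by
its set of `d + 1` vertices, any two of which intersect at most in their common face. -/
structure Triangulation (d : ℕ) where
  /-- the mesh elements -/
  elems : Finset (Finset (Pt d))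
  card_elem : ∀ T ∈ elems, T.card = d + 1
  affineIndependent : ∀ T ∈ elems, AffineIndependent ℝ ((↑) : T → Pt d)
  inter_subset : ∀ T ∈ elems, ∀ T' ∈ elems,
    hull T ∩ hull T' ⊆ convexHull ℝ ((T : Set (Pt d)) ∩ (T' : Set (Pt d)))

namespace Triangulation

variable {d : ℕ} (𝒯 : Triangulation d)

/-- The triangulated domain `Ω`. A bounded Lipschitz domain is the interior of its closure, and the
closure is the union of the closed mesh elements; so every triangulated bounded simplicial Lipschitz
domain is of this form. -/
def domain : Set (Pt d) := interior (⋃ T ∈ 𝒯.elems, hull T)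

open scoped Classical in
/-- The sides (facets of elements), each given by its `d` vertices. -/
def sides : Finset (Finset (Pt d)) := 𝒯.elems.biUnion fun T => T.powersetCard d

open scoped Classical in
/-- The interior sides: the common sides of two different elements. -/
def interiorSides : Finset (Finset (Pt d)) :=
  𝒯.sides.filter fun S => ∃ T ∈ 𝒯.elems, ∃ T' ∈ 𝒯.elems, T ≠ T' ∧
    (S : Set (Pt d)) = (T : Set (Pt d)) ∩ (T' : Set (Pt d))

open scoped Classical in
/-- The boundary sides: the sides lying on the topological boundary `∂Ω`. -/
def boundarySides : Finset (Finset (Pt d)) :=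
  𝒯.sides.filter fun S => hull S ⊆ frontier 𝒯.domain

open scoped Classical in
/-- The boundary sides whose (relative) interior is contained in the boundary part `Γ`. -/
def sidesIn (Γ : Set (Pt d)) : Finset (Finset (Pt d)) :=
  𝒯.boundarySides.filter fun S => intrinsicInterior ℝ (hull S) ⊆ Γ

open scoped Classical in
/-- The elements having `S` as a side: two for an interior side, one for a boundary side. -/
def adjacent (S : Finset (Pt d)) : Finset 𝒯.elems :=
  Finset.univ.filter fun T => S ⊆ T.1

/-- `ℒ⁰(𝒯)`: an element-wise constant function is the family of its values on the elements. -/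
abbrev L0 : Type := 𝒯.elems → ℝ

/-- `ℒ⁰(𝒯)^d`: element-wise constant vector fields. -/
abbrev L0Vec : Type := 𝒯.elems → Pt d

/-- `ℒ¹(𝒯)`: an element-wise affine function is the family of the affine functions
to which it restricts on the (full-dimensional) elements. -/
abbrev L1 : Type := 𝒯.elems → (Pt d →ᵃ[ℝ] ℝ)

/-- `ℒ¹(𝒯)^d`: element-wise affine vector fields. -/
abbrev L1Vec : Type := 𝒯.elems → (Pt d →ᵃ[ℝ] Pt d)

end Triangulation

section Elementwise

variable {d : ℕ}

/-- The mean value of `f` over the simplex `T` with respect to the Lebesgue measure. -/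
def elemMean {F : Type*} [NormedAddCommGroup F] [NormedSpace ℝ F]
    (T : Finset (Pt d)) (f : Pt d → F) : F := ⨍ x in hull T, f x

/-- The surface measure, that is, the `(d-1)`-dimensional Hausdorff measure, normalised
to agree with the Lebesgue measure on hyperplanes. -/
def surface (d : ℕ) : Measure (Pt d) := Measure.euclideanHausdorffMeasure (d - 1)

/-- The surface integral of `f` over the side `S`. -/
def sideIntegral (S : Finset (Pt d)) (f : Pt d → ℝ) : ℝ := ∫ x in hull S, f x ∂(surface d)

/-- The mean value of `f` over the side `S` with respect to the surface measure. -/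
def sideMean (S : Finset (Pt d)) (f : Pt d → ℝ) : ℝ := ⨍ x in hull S, f x ∂(surface d)

/-- The outward unit normal of the simplex `T` on its side `S`: the normalised component, orthogonal
to `S`, of the vector from the barycentre of `T` to the barycentre of `S`. -/
def outerNormal (T S : Finset (Pt d)) : Pt d :=
  let w : Pt d := (vectorSpan ℝ (S : Set (Pt d)))ᗮ.starProjection
    (S.centroid ℝ id - T.centroid ℝ id)
  ‖w‖⁻¹ • w

/-- The (constant) gradient of an affine function. -/
def affineGrad (v : Pt d →ᵃ[ℝ] ℝ) : Pt d :=
  (InnerProductSpace.toDual ℝ (Pt d)).symm (LinearMap.toContinuousLinearMap v.linear)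

/-- The (constant) divergence of an affine vector field: the trace of its derivative. -/
def affineDiv (y : Pt d →ᵃ[ℝ] Pt d) : ℝ := LinearMap.trace ℝ (Pt d) y.linear

end Elementwise

namespace Triangulation

variable {d : ℕ} (𝒯 : Triangulation d)

/-- The element-wise gradient `∇_h`. -/
def grad (v : 𝒯.L1) : 𝒯.L0Vec := fun T => affineGrad (v T)

/-- The (element-wise) divergence. -/
def div (y : 𝒯.L1Vec) : 𝒯.L0 := fun T => affineDiv (y T)

/-- The projection `Π_h` of scalar functions onto element-wise constants. -/
def proj (v : 𝒯.L1) : 𝒯.L0 := fun T => elemMean T.1 (v T)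

/-- The projection `Π_h` of vector fields onto element-wise constants. -/
def projVec (y : 𝒯.L1Vec) : 𝒯.L0Vec := fun T => elemMean T.1 (y T)

/-- The `L²(Ω)` inner product `(a, b)_Ω` of element-wise constant functions. -/
def innerL0 (a b : 𝒯.L0) : ℝ := ∑ T : 𝒯.elems, ∫ _x in hull T.1, a T * b T

/-- The `L²(Ω)^d` inner product `(a, b)_Ω` of element-wise constant vector fields. -/
def innerL0Vec (a b : 𝒯.L0Vec) : ℝ := ∑ T : 𝒯.elems, ∫ _x in hull T.1, ⟪a T, b T⟫

/-- The trace of `v` on a boundary side `S` (which belongs to exactly one element). -/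
def trace (v : 𝒯.L1) (S : Finset (Pt d)) (x : Pt d) : ℝ := ∑ T ∈ 𝒯.adjacent S, v T x

/-- `π_h v` on a boundary side `S`: the mean value over `S` of the trace of `v`. -/
def traceMean (v : 𝒯.L1) (S : Finset (Pt d)) : ℝ := sideMean S (𝒯.trace v S)

/-- The normal jump of `y` across `S`: the sum, over the elements `T` having `S` as a side, of
`y|_T · n_T`. On a boundary side it has one term and is the normal trace `y · n`. -/
def normalJump (y : 𝒯.L1Vec) (S : Finset (Pt d)) (x : Pt d) : ℝ :=
  ∑ T ∈ 𝒯.adjacent S, ⟪y T x, outerNormal T.1 S⟫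

/-- The Crouzeix--Raviart space: the mean value of the jump vanishes on every interior side. -/
def CR : Set 𝒯.L1 :=
  {v | ∀ S ∈ 𝒯.interiorSides, ∀ T ∈ 𝒯.adjacent S, ∀ T' ∈ 𝒯.adjacent S,
    sideMean S (fun x => v T x - v T' x) = 0}

/-- The lowest order Raviart--Thomas space: the normal component is constant on each side of each
element, and the normal jump vanishes on every interior side. -/
def RT : Set 𝒯.L1Vec :=
  {y | (∀ T : 𝒯.elems, ∀ S ∈ T.1.powersetCard d, ∃ c : ℝ, ∀ x ∈ hull S,
        ⟪y T x, outerNormal T.1 S⟫ = c) ∧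
      ∀ S ∈ 𝒯.interiorSides, ∀ x ∈ hull S, 𝒯.normalJump y S x = 0}

/-- A decomposition of `∂Ω` into disjoint relatively open parts (insulated, Dirichlet, Neumann) that
is resolved by the triangulation. -/
structure BoundaryParts where
  /-- insulated part -/
  ΓI : Set (Pt d)
  /-- Dirichlet part -/
  ΓD : Set (Pt d)
  /-- Neumann part -/
  ΓN : Set (Pt d)
  relOpen_I : ∃ U : Set (Pt d), IsOpen U ∧ ΓI = U ∩ frontier 𝒯.domain
  relOpen_D : ∃ U : Set (Pt d), IsOpen U ∧ ΓD = U ∩ frontier 𝒯.domain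
  relOpen_N : ∃ U : Set (Pt d), IsOpen U ∧ ΓN = U ∩ frontier 𝒯.domain
  disjoint_ID : Disjoint ΓI ΓD
  disjoint_IN : Disjoint ΓI ΓN
  disjoint_DN : Disjoint ΓD ΓN
  cover : frontier 𝒯.domain = closure ΓI ∪ closure ΓD ∪ closure ΓN
  nonempty_I : ΓI.Nonempty
  resolved : ∀ S ∈ 𝒯.boundarySides,
    S ∈ 𝒯.sidesIn ΓI ∨ S ∈ 𝒯.sidesIn ΓD ∨ S ∈ 𝒯.sidesIn ΓN

/-- `ℒ⁰` of the sides in the boundary part `Γ`: side-wise constant functions on `Γ`. -/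
abbrev L0Sides (Γ : Set (Pt d)) : Type := 𝒯.sidesIn Γ → ℝ

namespace BoundaryParts

variable {𝒯} (Γ : 𝒯.BoundaryParts)

/-- The space of Raviart--Thomas fields with vanishing normal trace on the Neumann part. -/
def RTN : Set 𝒯.L1Vec :=
  {y | y ∈ 𝒯.RT ∧ ∀ S ∈ 𝒯.sidesIn Γ.ΓN, ∀ x ∈ hull S, 𝒯.normalJump y S x = 0}

open scoped Classical in
/-- The discrete primal energy functional with values in `ℝ ∪ {+∞}`:
`½‖∇_h v‖²_Ω + (1/(2m))‖π_h v‖²_{1,Γ_I} - (f, Π_h v)_Ω - (g, π_h v)_{Γ_N}` if `π_h v = u_D` on `Γ_D`,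
and `+∞` otherwise. -/
def primalEnergy (m : ℝ) (f : 𝒯.L0) (g : 𝒯.L0Sides Γ.ΓN) (uD : 𝒯.L0Sides Γ.ΓD)
    (v : 𝒯.L1) : EReal :=
  if ∀ S : 𝒯.sidesIn Γ.ΓD, 𝒯.traceMean v S = uD S then
    ((1 / 2 * 𝒯.innerL0Vec (𝒯.grad v) (𝒯.grad v)
      + 1 / (2 * m) * (∑ S : 𝒯.sidesIn Γ.ΓI, sideIntegral S.1 fun _ => |𝒯.traceMean v S|) ^ 2
      - 𝒯.innerL0 f (𝒯.proj v)
      - ∑ S : 𝒯.sidesIn Γ.ΓN, sideIntegral S.1 fun _ => g S * 𝒯.traceMean v S : ℝ) : EReal)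
  else ⊤

/-- `u` is a discrete primal solution: it belongs to the effective domain of the discrete primal
energy and minimises this energy over the Crouzeix--Raviart space. -/
def IsPrimalSolution (m : ℝ) (f : 𝒯.L0) (g : 𝒯.L0Sides Γ.ΓN) (uD : 𝒯.L0Sides Γ.ΓD)
    (u : 𝒯.L1) : Prop :=
  u ∈ 𝒯.CR ∧ Γ.primalEnergy m f g uD u ≠ ⊤ ∧
    ∀ v ∈ 𝒯.CR, Γ.primalEnergy m f g uD u ≤ Γ.primalEnergy m f g uD v

/-- The KKT system of the augmented discrete dual problem. -/
structure IsKKT (m : ℝ) (f : 𝒯.L0) (g : 𝒯.L0Sides Γ.ΓN) (uD : 𝒯.L0Sides Γ.ΓD)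
    (z : 𝒯.L1Vec) (ubar : 𝒯.L0) (μ : ℝ) (lamP lamM : 𝒯.L0Sides Γ.ΓI) : Prop where
  mem_RT : z ∈ 𝒯.RT
  neumann : ∀ S : 𝒯.sidesIn Γ.ΓN, ∀ x ∈ hull S.1, 𝒯.normalJump z S x = g S
  stationary : ∀ y ∈ Γ.RTN,
    𝒯.innerL0Vec (𝒯.projVec z) (𝒯.projVec y) + 𝒯.innerL0 ubar (𝒯.div y)
      + ∑ S : 𝒯.sidesIn Γ.ΓI, sideIntegral S.1 (fun x => (lamP S - lamM S) * 𝒯.normalJump y S x)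
    = ∑ S : 𝒯.sidesIn Γ.ΓD, sideIntegral S.1 (fun x => uD S * 𝒯.normalJump y S x)
  divergence : ∀ v : 𝒯.L0, 𝒯.innerL0 (𝒯.div z) v = -𝒯.innerL0 f v
  multiplier : ∀ η : ℝ,
    m * μ * η + ∑ S : 𝒯.sidesIn Γ.ΓI, sideIntegral S.1 (fun _ => (lamP S + lamM S) * η) = 0
  feasible_pos : ∀ S : 𝒯.sidesIn Γ.ΓI, ∀ x ∈ hull S.1, 0 ≤ μ + 𝒯.normalJump z S x
  feasible_neg : ∀ S : 𝒯.sidesIn Γ.ΓI, ∀ x ∈ hull S.1, 0 ≤ μ - 𝒯.normalJump z S x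
  complementary_pos : ∀ S : 𝒯.sidesIn Γ.ΓI, ∀ x ∈ hull S.1,
    lamP S * (μ + 𝒯.normalJump z S x) = 0
  complementary_neg : ∀ S : 𝒯.sidesIn Γ.ΓI, ∀ x ∈ hull S.1,
    lamM S * (μ - 𝒯.normalJump z S x) = 0
  sign_pos : ∀ S : 𝒯.sidesIn Γ.ΓI, lamP S ≤ 0
  sign_neg : ∀ S : 𝒯.sidesIn Γ.ΓI, lamM S ≤ 0

end BoundaryParts

end Triangulation

end OptimalInsulation

end

/-! The argument is convex duality made exact by a discrete integration by parts. All integrands are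
affine or constant, so everything rests on one fact: the mean of an affine function over a simplex
of any dimension is its value at the barycentre (`setAverage_affineMap`,
`euclideanHausdorffMeasure_simplex`). With the height formula for the volume (`exists_height`) it
gives Green's formula on an element (`green_element`). Summed over the mesh, this becomes
`green_sides` for arbitrary element-wise affine v, and `green_CR` when v has no mean jumps.

Membership. Let u have gradients Π_h z and means ū. By `green_sides`, the first two terms of the
stationarity condition are a sum over sides of y·n times the value of u at the side barycentre.
Testing with fields whose normal component lives on a single side (`stationary_side`) shows that u
has no mean jump on interior sides, trace mean u_D on Γ_D, and trace mean λ⁻ - λ⁺ on Γ_I.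

Minimality. For an admissible v put A = ‖π_h v‖_{L¹(Γ_I)}. By `green_dual`, the energy of v is ½‖∇_h
v‖² - (∇_h v, Π_h z) + A²/(2m) + (z·n, π_h v)_{Γ_I} plus a Dirichlet term independent of v.
Completing the square bounds the first two terms below by -½‖Π_h z‖². Since |z·n| ≤ μ on Γ_I, the
next two are at least A²/(2m) - μA ≥ -mμ²/2. For u all these bounds are equalities: ∇_h u = Π_h z,
and complementarity gives A = mμ (`sum_abs_traceMean`) and flux term -mμ² (`sum_flux_traceMean`). -/

noncomputable section

namespace OptimalInsulation

/-! ### Mean values of affine maps over a full-dimensional simplex -/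

section Simplex

variable {E : Type*} [NormedAddCommGroup E] [NormedSpace ℝ E] [FiniteDimensional ℝ E]
  [MeasurableSpace E] [BorelSpace E] {ι : Type*} [Fintype ι]

omit [FiniteDimensional ℝ E] [MeasurableSpace E] [BorelSpace E] in
theorem isCompact_convexHull_range (b : AffineBasis ι ℝ E) :
    IsCompact (convexHull ℝ (Set.range b)) :=
  (Set.finite_range b).isCompact_convexHull ℝ

omit [Fintype ι] in
/-- The affine involution exchanging the points `i` and `j` of an affine basis preserves every
Haar measure. -/
theorem measurePreserving_swap (μ : Measure E) [μ.IsAddHaarMeasure]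
    (b : AffineBasis ι ℝ E) {i j : ι} (hij : i ≠ j) :
    MeasurePreserving (fun x => x + (b.coord j x - b.coord i x) • (b i - b j)) μ μ := by
  set g : E →ᵃ[ℝ] ℝ := b.coord j - b.coord i with hg
  set u : E := b i - b j with hu
  -- The value -2 makes v ↦ v + g(v) u a reflection: its square is the identity, so its determinant
  -- is ±1.
  have hgu : g.linear u = -2 := by
    have h := g.linearMap_vsub (b i) (b j)
    simp only [vsub_eq_sub] at h
    rw [hu, h, hg]
    simp [hij, hij.symm]
    norm_num
  set L : E →ₗ[ℝ] E := LinearMap.id + g.linear.smulRight u with hL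
  have hLL : L ∘ₗ L = LinearMap.id := by
    ext v
    simp only [hL, LinearMap.comp_apply, LinearMap.add_apply, LinearMap.id_apply,
      LinearMap.smulRight_apply, map_add, map_smul, hgu]
    module
  have hdet : LinearMap.det L * LinearMap.det L = 1 := by
    rw [← LinearMap.det_comp, hLL, LinearMap.det_id]
  have habs : |(LinearMap.det L)⁻¹| = 1 := by
    rcases mul_self_eq_one_iff.1 hdet with h | h <;> rw [h] <;> norm_num
  have hLp : MeasurePreserving L μ μ := by
    refine ⟨L.continuous_of_finiteDimensional.measurable, ?_⟩
    rw [Measure.map_linearMap_addHaar_eq_smul_addHaar μ (fun h => by simp [h] at hdet), habs]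
    simp
  have h2 : (fun x => x + (b.coord j x - b.coord i x) • (b i - b j))
      = (fun x => x + g 0 • u) ∘ L := by
    funext x
    have : b.coord j x - b.coord i x = g.linear x + g 0 := by
      have := congrFun g.decomp x
      simpa [hg] using this
    simp only [Function.comp_apply, hL, LinearMap.add_apply, LinearMap.id_apply,
      LinearMap.smulRight_apply, this]
    module
  rw [h2]
  exact (measurePreserving_add_right μ _).comp hLp

/-- The affine swap of two vertices preserves the measure, maps the simplex onto itself and
interchanges the two barycentric coordinates. -/
theorem setIntegral_coord_eq (μ : Measure E) [μ.IsAddHaarMeasure]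
    (b : AffineBasis ι ℝ E) (i j : ι) :
    ∫ x in convexHull ℝ (Set.range b), b.coord i x ∂μ
      = ∫ x in convexHull ℝ (Set.range b), b.coord j x ∂μ := by
  classical
  rcases eq_or_ne i j with rfl | hij
  · rfl
  set A : E → E := fun x => x + (b.coord j x - b.coord i x) • (b i - b j) with hA
  have hAcoord : ∀ k x, b.coord k (A x)
      = b.coord k x + (b.coord j x - b.coord i x) * (b.coord k (b i) - b.coord k (b j)) := by
    intro k x
    have h1 := (b.coord k).map_vadd x ((b.coord j x - b.coord i x) • (b i - b j))
    have h2 := (b.coord k).linearMap_vsub (b i) (b j)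
    simp only [vsub_eq_sub, vadd_eq_add] at h1 h2
    rw [hA]
    simp only
    rw [add_comm x, h1, map_smul, h2, smul_eq_mul]
    ring
  have hAi : ∀ x, b.coord i (A x) = b.coord j x := by
    intro x; rw [hAcoord]; simp [hij]
  have hAj : ∀ x, b.coord j (A x) = b.coord i x := by
    intro x; rw [hAcoord]; simp [hij.symm]
  have hAk : ∀ k x, k ≠ i → k ≠ j → b.coord k (A x) = b.coord k x := by
    intro k x h1 h2; rw [hAcoord]; simp [h1, h2]
  have hAA : Function.Involutive A := by
    intro x
    apply b.ext_elem
    intro k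
    by_cases h1 : k = i
    · rw [h1, hAi, hAj]
    by_cases h2 : k = j
    · rw [h2, hAj, hAi]
    · rw [hAk _ _ h1 h2, hAk _ _ h1 h2]
  have hpre : A ⁻¹' (convexHull ℝ (Set.range b)) = convexHull ℝ (Set.range b) := by
    rw [b.convexHull_eq_nonneg_coord]
    ext x
    simp only [Set.mem_preimage, Set.mem_ofPred_eq]
    constructor <;> intro h k
    · by_cases h1 : k = i
      · have := h j; rwa [hAj, ← h1] at this
      by_cases h2 : k = j
      · have := h i; rwa [hAi, ← h2] at this
      · have := h k; rwa [hAk _ _ h1 h2] at this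
    · by_cases h1 : k = i
      · rw [h1, hAi]; exact h j
      by_cases h2 : k = j
      · rw [h2, hAj]; exact h i
      · rw [hAk _ _ h1 h2]; exact h k
  have hcont : Continuous A := by
    have := continuous_barycentric_coord b
    simp only [hA]
    exact continuous_id.add (((this j).sub (this i)).smul continuous_const)
  have hemb : MeasurableEmbedding A :=
    (Homeomorph.mk (hAA.toPerm A) hcont hcont).measurableEmbedding
  have h := (measurePreserving_swap μ b hij).setIntegral_preimage_emb hemb
    (fun x => b.coord i x) (convexHull ℝ (Set.range b))
  rw [← h]
  change ∫ x in A ⁻¹' _, b.coord i (A x) ∂μ = _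
  rw [hpre]
  simp only [hAi]

omit [FiniteDimensional ℝ E] [MeasurableSpace E] [BorelSpace E] in
theorem affineMap_eq_sum_coord {F : Type*} [AddCommGroup F] [Module ℝ F]
    (b : AffineBasis ι ℝ E) (f : E →ᵃ[ℝ] F) (x : E) : f x = ∑ i, b.coord i x • f (b i) := by
  conv_lhs => rw [← b.affineCombination_coord_eq_self x]
  rw [Finset.map_affineCombination _ _ _ (b.sum_coord_apply_eq_one x),
    Finset.affineCombination_eq_linear_combination _ _ _ (b.sum_coord_apply_eq_one x)]
  rfl

omit [FiniteDimensional ℝ E] [MeasurableSpace E] [BorelSpace E] in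
theorem affineMap_centroid {F : Type*} [AddCommGroup F] [Module ℝ F]
    (b : AffineBasis ι ℝ E) (f : E →ᵃ[ℝ] F) :
    f (Finset.univ.centroid ℝ b) = (Fintype.card ι : ℝ)⁻¹ • ∑ i, f (b i) := by
  rw [affineMap_eq_sum_coord b, Finset.smul_sum]
  refine Finset.sum_congr rfl fun i hi => ?_
  rw [b.coord_apply_centroid hi, Finset.card_univ]

omit [FiniteDimensional ℝ E] [BorelSpace E] in
theorem measure_convexHull_range_pos (μ : Measure E) [μ.IsAddHaarMeasure] (b : AffineBasis ι ℝ E) :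
    0 < μ.real (convexHull ℝ (Set.range b)) := by
  refine ENNReal.toReal_pos ?_ (isCompact_convexHull_range b).measure_lt_top.ne
  exact (Measure.measure_pos_of_nonempty_interior μ
    ⟨_, b.centroid_mem_interior_convexHull⟩).ne'

/-- The mean value of an affine map over a simplex is its value at the centroid. -/
theorem setAverage_affineMap (μ : Measure E) [μ.IsAddHaarMeasure] {F : Type*}
    [NormedAddCommGroup F] [NormedSpace ℝ F] [CompleteSpace F] (b : AffineBasis ι ℝ E) (f : E →ᵃ[ℝ] F) :
    ⨍ x in convexHull ℝ (Set.range b), f x ∂μ = f (Finset.univ.centroid ℝ b) := by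
  have hne := b.nonempty
  have hK := isCompact_convexHull_range b
  set K := convexHull ℝ (Set.range b) with hKdef
  have hpos : 0 < μ.real K := measure_convexHull_range_pos μ b
  have hint : ∀ i, IntegrableOn (fun x => b.coord i x) K μ := fun i =>
    (continuous_barycentric_coord b i).continuousOn.integrableOn_compact hK
  -- The coordinates have equal integrals and sum to one, so each takes an equal share of the
  -- volume.
  have hcoord : ∀ i, ∫ x in K, b.coord i x ∂μ = (Fintype.card ι : ℝ)⁻¹ * μ.real K := by
    intro i
    have h1 : ∑ j, ∫ x in K, b.coord j x ∂μ = μ.real K := by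
      rw [← integral_finsetSum _ fun j _ => hint j]
      simp [b.sum_coord_apply_eq_one]
    rw [Finset.sum_congr rfl fun j _ => setIntegral_coord_eq μ b j i] at h1
    rw [← h1, hKdef]
    simp
  rw [setAverage_eq, affineMap_centroid b f]
  have h2 : ∫ x in K, f x ∂μ = ∑ i, (∫ x in K, b.coord i x ∂μ) • f (b i) := by
    rw [integral_congr_ae (.of_forall fun x => affineMap_eq_sum_coord b f x)]
    rw [integral_finsetSum _ fun j _ => (hint j).smul_const _]
    exact Finset.sum_congr rfl fun i _ => integral_smul_const _ _
  rw [h2, Finset.smul_sum, Finset.smul_sum]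
  refine Finset.sum_congr rfl fun i _ => ?_
  rw [hcoord, smul_smul]
  congr 1
  field_simp

end Simplex

/-! ### Surface measure on lower-dimensional simplices -/

section Side

variable {E : Type*} [NormedAddCommGroup E] [InnerProductSpace ℝ E] [FiniteDimensional ℝ E]
  [MeasurableSpace E] [BorelSpace E]

omit [FiniteDimensional ℝ E] [MeasurableSpace E] [BorelSpace E] in
/-- An affinely independent set of points, shifted to the origin, is an affine basis of the
direction of its affine span. -/
theorem exists_affineBasis_vectorSpan {S : Finset E} {s₀ : E} (h₀ : s₀ ∈ S)
    (hS : AffineIndependent ℝ ((↑) : S → E)) :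
    ∃ b : AffineBasis S ℝ (vectorSpan ℝ (S : Set E)), ∀ s : S, (b s : E) + s₀ = s := by
  let p : S → vectorSpan ℝ (S : Set E) := fun s => ⟨s - s₀, vsub_mem_vectorSpan ℝ s.2 h₀⟩
  have hp : ∀ s, (p s : E) + s₀ = s := fun s => sub_add_cancel _ _
  let φ : vectorSpan ℝ (S : Set E) →ᵃ[ℝ] E :=
    (vectorSpan ℝ (S : Set E)).subtype.toAffineMap + AffineMap.const ℝ _ s₀
  have hφ : φ ∘ p = ((↑) : S → E) := funext hp
  have hind : AffineIndependent ℝ p := .of_comp φ (hφ ▸ hS)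
  have : FiniteDimensional ℝ (vectorSpan ℝ (S : Set E)) :=
    finiteDimensional_vectorSpan_of_finite ℝ S.finite_toSet
  have hcard : Fintype.card S = (S.card - 1) + 1 := by
    rw [Fintype.card_coe, Nat.sub_add_cancel (Finset.card_pos.2 ⟨_, h₀⟩)]
  refine ⟨⟨p, hind, ?_⟩, hp⟩
  rw [hind.affineSpan_eq_top_iff_card_eq_finrank_add_one, hcard]
  have := hS.finrank_vectorSpan hcard
  rw [Subtype.range_coe_subtype] at this
  rw [← this]
  rfl

omit [FiniteDimensional ℝ E] [MeasurableSpace E] [BorelSpace E] in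
/-- The Hausdorff measure on a simplex of dimension `k` is the image of the Lebesgue measure on a
simplex in a `k`-dimensional space. -/
theorem exists_simplex_parametrization {S : Finset E} {k : ℕ} (hk : S.card = k + 1)
    (hS : AffineIndependent ℝ ((↑) : S → E)) :
    ∃ (b : AffineBasis S ℝ (vectorSpan ℝ (S : Set E)))
      (φ : vectorSpan ℝ (S : Set E) →ᵃ[ℝ] E), Isometry φ ∧ (∀ s, φ (b s) = s) ∧
      Module.finrank ℝ (vectorSpan ℝ (S : Set E)) = k := by
  obtain ⟨s₀, h₀⟩ : S.Nonempty := Finset.card_pos.1 (by omega)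
  obtain ⟨b, hb⟩ := exists_affineBasis_vectorSpan h₀ hS
  refine ⟨b, (vectorSpan ℝ (S : Set E)).subtype.toAffineMap + AffineMap.const ℝ _ s₀, ?_, hb, ?_⟩
  · refine Isometry.of_dist_eq fun x y => ?_
    simp [dist_eq_norm]
  · have := hS.finrank_vectorSpan (n := k) (by simpa using hk)
    rw [Subtype.range_coe_subtype] at this
    exact this

omit [FiniteDimensional ℝ E] in
/-- A `k`-dimensional simplex has positive, finite `k`-dimensional measure, and the mean value of an
affine function over it is the value at the centroid. -/
theorem euclideanHausdorffMeasure_simplex {S : Finset E} {k : ℕ} (hk : S.card = k + 1)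
    (hS : AffineIndependent ℝ ((↑) : S → E)) :
    0 < (Measure.euclideanHausdorffMeasure k).real (convexHull ℝ (S : Set E)) ∧
    (Measure.euclideanHausdorffMeasure k) (convexHull ℝ (S : Set E)) ≠ ⊤ ∧
    ∀ f : E →ᵃ[ℝ] ℝ, ⨍ x in convexHull ℝ (S : Set E), f x ∂(Measure.euclideanHausdorffMeasure k)
      = f (S.centroid ℝ id) := by
  obtain ⟨b, φ, hφ, hb, hrank⟩ := exists_simplex_parametrization hk hS
  have : FiniteDimensional ℝ (vectorSpan ℝ (S : Set E)) :=
    finiteDimensional_vectorSpan_of_finite ℝ S.finite_toSet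
  have himg : convexHull ℝ (S : Set E) = φ '' convexHull ℝ (Set.range b) := by
    rw [φ.image_convexHull, ← Set.range_comp]
    congr 1
    ext x
    simp [hb]
  have hvol : (Measure.euclideanHausdorffMeasure k : Measure (vectorSpan ℝ (S : Set E)))
      = volume := by
    rw [← hrank]; exact InnerProductSpace.euclideanHausdorffMeasure_eq_volume
  have hm : Measure.euclideanHausdorffMeasure k (convexHull ℝ (S : Set E))
      = volume (convexHull ℝ (Set.range b)) := by
    rw [himg, hφ.euclideanHausdorffMeasure_image, hvol]
  have hmr : (Measure.euclideanHausdorffMeasure k).real (convexHull ℝ (S : Set E))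
      = volume.real (convexHull ℝ (Set.range b)) := by
    rw [measureReal_def, hm, measureReal_def]
  refine ⟨?_, ?_, fun f => ?_⟩
  · rw [hmr]
    exact measure_convexHull_range_pos _ b
  · rw [hm]
    exact (isCompact_convexHull_range b).measure_lt_top.ne
  · have hres : (Measure.euclideanHausdorffMeasure k).restrict (convexHull ℝ (S : Set E))
        = (volume.map φ).restrict (convexHull ℝ (S : Set E)) := by
      rw [← hvol, hφ.map_euclideanHausdorffMeasure, Measure.restrict_restrict_of_subset]
      rw [himg]
      exact Set.image_subset_range _ _
    have hpre : φ ⁻¹' convexHull ℝ (S : Set E) = convexHull ℝ (Set.range b) := by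
      rw [himg, Set.preimage_image_eq _ hφ.injective]
    have h := setAverage_affineMap volume b (f.comp φ)
    rw [setAverage_eq] at h ⊢
    rw [hmr, hres, hφ.isClosedEmbedding.measurableEmbedding.setIntegral_map, hpre]
    simp only [AffineMap.comp_apply] at h
    rw [h]
    congr 1
    have hne := b.nonempty
    rw [Finset.centroid_def, Finset.map_affineCombination _ _ _
      (Finset.sum_centroidWeights_eq_one_of_nonempty ℝ _ Finset.univ_nonempty),
      ← Finset.centroid_def, ← Finset.centroid_univ]
    congr 1
    funext s
    exact hb s

end Side

/-! ### Volume of a cone over a flat base -/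

section Pyramid

variable {E : Type*} [NormedAddCommGroup E] [InnerProductSpace ℝ E] [FiniteDimensional ℝ E]
  [MeasurableSpace E] [BorelSpace E]

/-- The volume of the pyramid with base `K` and apex `p`: the base times the height, divided by
the dimension. -/
theorem volume_convexJoin_singleton {K : Set E} (hK : IsCompact K) {p v : E}
    (hv : v ≠ 0) (hKv : ∀ x ∈ K, ⟪x - p, v⟫ = ‖v‖ ^ 2)
    (hfin : Measure.euclideanHausdorffMeasure (Module.finrank ℝ E - 1) K ≠ ⊤) :
    Module.finrank ℝ E * volume.real (convexJoin ℝ {p} K) = ‖v‖ *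
      (Measure.euclideanHausdorffMeasure (Module.finrank ℝ E - 1)).real K := by
  set n := Module.finrank ℝ E with hn
  set t := convexJoin ℝ {p} K with ht
  have hmem : ∀ y, y ∈ t ↔ ∃ x ∈ Set.Icc (0 : ℝ) 1, ∃ s ∈ K, p + x • (s - p) = y := by
    intro y
    simp only [ht, mem_convexJoin, Set.mem_singleton_iff, exists_eq_left, segment_eq_image',
      Set.mem_image]
    exact ⟨fun ⟨s, hs, x, hx, h⟩ => ⟨x, hx, s, hs, h⟩, fun ⟨x, hx, s, hs, h⟩ => ⟨s, hs, x, hx, h⟩⟩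
  have htc : IsCompact t := by
    have : t = (fun q : ℝ × E => p + q.1 • (q.2 - p)) '' (Set.Icc 0 1 ×ˢ K) := by
      ext y
      rw [hmem]
      constructor
      · rintro ⟨x, hx, s, hs, h⟩
        exact ⟨(x, s), ⟨hx, hs⟩, h⟩
      · rintro ⟨⟨x, s⟩, ⟨hx, hs⟩, h⟩
        exact ⟨x, hx, s, hs, h⟩
    rw [this]
    exact (isCompact_Icc.prod hK).image (by fun_prop)
  have hnpos : 0 < n := by
    have : Nontrivial E := ⟨v, 0, hv⟩
    exact Module.finrank_pos
  -- The inner product with v reads off the scaling parameter, because the base lies in the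
  -- hyperplane through p + v orthogonal to v. The slice at parameter x is thus the base scaled by x
  -- about the apex.
  have hslice : ∀ x y, y ∈ t ∩ (AffineSubspace.mk' (x • v +ᵥ p) (ℝ ∙ v)ᗮ : Set E) ↔
      x ∈ Set.Icc (0 : ℝ) 1 ∧ ∃ s ∈ K, p + x • (s - p) = y := by
    intro x y
    have hv2 : ‖v‖ ^ 2 ≠ 0 := by positivity
    have key : ∀ x' : ℝ, ∀ s ∈ K,
        (p + x' • (s - p) ∈ (AffineSubspace.mk' (x • v +ᵥ p) (ℝ ∙ v)ᗮ : Set E) ↔ x' = x) := by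
      intro x' s hs
      rw [SetLike.mem_coe, AffineSubspace.mem_mk', Submodule.mem_orthogonal_singleton_iff_inner_left]
      have : p + x' • (s - p) -ᵥ (x • v +ᵥ p) = x' • (s - p) - x • v := by
        simp only [vsub_eq_sub, vadd_eq_add]; abel
      rw [this, inner_sub_left, inner_smul_left, inner_smul_left, hKv s hs,
        real_inner_self_eq_norm_sq]
      simp only [conj_trivial]
      rw [← sub_mul, mul_eq_zero, or_iff_left hv2, sub_eq_zero]
    rw [Set.mem_inter_iff, hmem]
    constructor
    · rintro ⟨⟨x', hx', s, hs, rfl⟩, h⟩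
      obtain rfl := (key x' s hs).1 h
      exact ⟨hx', s, hs, rfl⟩
    · rintro ⟨hx, s, hs, rfl⟩
      exact ⟨⟨x, hx, s, hs, rfl⟩, (key x s hs).2 rfl⟩
  set c := Measure.euclideanHausdorffMeasure (n - 1) K with hc
  -- The scaling law needs a nonzero ratio; the slice through the apex is a null event in x and is
  -- dropped below.
  have hint : ∀ x : ℝ, x ≠ 0 → Measure.euclideanHausdorffMeasure (n - 1)
      (t ∩ (AffineSubspace.mk' (x • v +ᵥ p) (ℝ ∙ v)ᗮ : Set E))
      = (Set.Ioc (0 : ℝ) 1).indicator (fun x => ENNReal.ofReal (x ^ (n - 1)) * c) x := by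
    intro x hx0
    by_cases hx : x ∈ Set.Ioc (0 : ℝ) 1
    · have : t ∩ (AffineSubspace.mk' (x • v +ᵥ p) (ℝ ∙ v)ᗮ : Set E)
          = AffineMap.homothety p x '' K := by
        ext y
        rw [hslice]
        simp only [Set.Ioc_subset_Icc_self hx, true_and, Set.mem_image, AffineMap.homothety_apply,
          vsub_eq_sub, vadd_eq_add, add_comm p]
      rw [this, euclideanHausdorffMeasure_homothety_image _ _ hx0, Set.indicator_of_mem hx,
        ENNReal.smul_def, smul_eq_mul, ← hc]
      congr 1
      rw [ENNReal.coe_pow, ← enorm_eq_nnnorm, Real.enorm_of_nonneg hx.1.le,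
        ENNReal.ofReal_pow hx.1.le]
    · have : t ∩ (AffineSubspace.mk' (x • v +ᵥ p) (ℝ ∙ v)ᗮ : Set E) = ∅ := by
        ext y
        rw [hslice]
        simp only [Set.mem_empty_iff_false, iff_false]
        rintro ⟨h, -⟩
        exact hx ⟨lt_of_le_of_ne h.1 hx0.symm, h.2⟩
      rw [this, Set.indicator_of_notMem hx, measure_empty]
  have hae : ∀ᵐ x : ℝ, x ≠ 0 := by
    simp [ae_iff]
  have hpow : ∫⁻ x in Set.Ioc (0 : ℝ) 1, ENNReal.ofReal (x ^ (n - 1))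
      = ENNReal.ofReal ((n : ℝ)⁻¹) := by
    rw [← ofReal_integral_eq_lintegral_ofReal, ← intervalIntegral.integral_of_le zero_le_one,
      integral_pow]
    · have : ((n - 1 : ℕ) : ℝ) + 1 = n := by
        rw [Nat.cast_sub hnpos]; simp
      rw [this, Nat.sub_add_cancel hnpos]
      simp [hnpos.ne']
    · exact ((continuous_pow _).integrableOn_Icc).mono_set Set.Ioc_subset_Icc_self
    · filter_upwards [ae_restrict_mem measurableSet_Ioc] with x hx
      exact pow_nonneg hx.1.le _
  -- Cavalieri's principle along v: the slices have measure x^(n-1) c, and ∫₀¹ x^(n-1) dx = 1/n.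
  have hvol : volume t = ‖v‖ₑ * (ENNReal.ofReal ((n : ℝ)⁻¹) * c) := by
    rw [← InnerProductSpace.euclideanHausdorffMeasure_eq_volume,
      EuclideanGeometry.euclideanHausdorffMeasure_eq_lintegral p hv htc.measurableSet,
      lintegral_congr_ae (hae.mono hint), lintegral_indicator measurableSet_Ioc,
      lintegral_mul_const' _ _ hfin, hpow]
  rw [measureReal_def, hvol, measureReal_def, ← hc]
  simp only [ENNReal.toReal_mul, toReal_enorm]
  rw [ENNReal.toReal_ofReal (by positivity)]
  have : (n : ℝ) ≠ 0 := by positivity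
  field_simp

end Pyramid
end OptimalInsulation

namespace OptimalInsulation

/-! ### Sums of affine maps and values at barycentres -/

section AffineMap

variable {ι E F : Type*} [AddCommGroup E] [Module ℝ E] [AddCommGroup F] [Module ℝ F]

theorem affineMap_sum_apply (s : Finset ι) (f : ι → E →ᵃ[ℝ] F) (x : E) :
    (∑ i ∈ s, f i) x = ∑ i ∈ s, f i x := by
  classical
  induction s using Finset.induction_on with
  | empty => simp
  | insert a s ha ih => simp [Finset.sum_insert ha, ih]

theorem affineMap_sum_linear (s : Finset ι) (f : ι → E →ᵃ[ℝ] F) :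
    (∑ i ∈ s, f i).linear = ∑ i ∈ s, (f i).linear := by
  classical
  induction s using Finset.induction_on with
  | empty => simp
  | insert a s ha ih => simp [Finset.sum_insert ha, ih]

end AffineMap

section Centroid

theorem affineMap_finset_centroid {E F : Type*} [AddCommGroup E] [Module ℝ E] [AddCommGroup F]
    [Module ℝ F] {S : Finset E} (hS : S.Nonempty) (f : E →ᵃ[ℝ] F) :
    f (S.centroid ℝ id) = (S.card : ℝ)⁻¹ • ∑ s ∈ S, f s := by
  have h := Finset.sum_centroidWeights_eq_one_of_nonempty ℝ S hS
  rw [Finset.centroid_def, Finset.map_affineCombination _ _ _ h,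
    Finset.affineCombination_eq_linear_combination _ _ _ h, Finset.smul_sum]
  rfl

theorem centroid_eq_smul_sum {E : Type*} [AddCommGroup E] [Module ℝ E] {S : Finset E}
    (hS : S.Nonempty) : S.centroid ℝ id = (S.card : ℝ)⁻¹ • ∑ s ∈ S, s :=
  affineMap_finset_centroid hS (AffineMap.id ℝ E)

end Centroid

/-! ### Geometry of one element and Green's formula on it -/

section Element

variable {d : ℕ} {T : Finset (Pt d)}

/-- The vertices of a non-degenerate `d`-simplex form an affine basis. -/
def elemBasis (hc : T.card = d + 1) (hT : AffineIndependent ℝ ((↑) : T → Pt d)) :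
    AffineBasis T ℝ (Pt d) :=
  ⟨(↑), hT, by
    rw [hT.affineSpan_eq_top_iff_card_eq_finrank_add_one]
    simp [hc]⟩

@[simp]
theorem elemBasis_apply (hc : T.card = d + 1) (hT : AffineIndependent ℝ ((↑) : T → Pt d))
    (t : T) : elemBasis hc hT t = t := rfl

theorem hull_eq_convexHull_range (hc : T.card = d + 1)
    (hT : AffineIndependent ℝ ((↑) : T → Pt d)) :
    hull T = convexHull ℝ (Set.range (elemBasis hc hT)) := by
  rw [hull]
  congr 1
  ext x
  simp

theorem isCompact_hull (S : Finset (Pt d)) : IsCompact (hull S) :=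
  S.finite_toSet.isCompact_convexHull ℝ

theorem convex_hull (S : Finset (Pt d)) : Convex ℝ (hull S) := convex_convexHull ℝ _

theorem subset_hull {S : Finset (Pt d)} {s : Pt d} (hs : s ∈ S) : s ∈ hull S :=
  subset_convexHull ℝ _ hs

theorem centroid_mem_hull {S : Finset (Pt d)} (hS : S.Nonempty) : S.centroid ℝ id ∈ hull S :=
  S.centroid_mem_convexHull hS

theorem elemMean_affineMap (hc : T.card = d + 1) (hT : AffineIndependent ℝ ((↑) : T → Pt d))
    {F : Type*} [NormedAddCommGroup F] [NormedSpace ℝ F] [CompleteSpace F] (f : Pt d →ᵃ[ℝ] F) :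
    elemMean T f = f (T.centroid ℝ id) := by
  rw [elemMean, hull_eq_convexHull_range hc hT, setAverage_affineMap, ← Finset.centroid_univ]
  rfl

theorem affineIndependent_side (hT : AffineIndependent ℝ ((↑) : T → Pt d))
    {S : Finset (Pt d)} (hS : S ⊆ T) : AffineIndependent ℝ ((↑) : S → Pt d) :=
  hT.mono (t := (T : Set (Pt d))) (by exact_mod_cast hS)

theorem side_card_eq (hd : 1 ≤ d) {S : Finset (Pt d)} (hS : S ∈ T.powersetCard d) :
    S.card = d - 1 + 1 := by
  rw [(Finset.mem_powersetCard.1 hS).2]; omega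

theorem surface_hull_pos (hd : 1 ≤ d) (hT : AffineIndependent ℝ ((↑) : T → Pt d))
    {S : Finset (Pt d)} (hS : S ∈ T.powersetCard d) : 0 < (surface d).real (hull S) :=
  (euclideanHausdorffMeasure_simplex (side_card_eq hd hS)
    (affineIndependent_side hT (Finset.mem_powersetCard.1 hS).1)).1

theorem surface_hull_ne_top (hd : 1 ≤ d) (hT : AffineIndependent ℝ ((↑) : T → Pt d))
    {S : Finset (Pt d)} (hS : S ∈ T.powersetCard d) : surface d (hull S) ≠ ⊤ :=
  (euclideanHausdorffMeasure_simplex (side_card_eq hd hS)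
    (affineIndependent_side hT (Finset.mem_powersetCard.1 hS).1)).2.1

theorem sideMean_affineMap (hd : 1 ≤ d) (hT : AffineIndependent ℝ ((↑) : T → Pt d))
    {S : Finset (Pt d)} (hS : S ∈ T.powersetCard d) (f : Pt d →ᵃ[ℝ] ℝ) :
    sideMean S f = f (S.centroid ℝ id) :=
  (euclideanHausdorffMeasure_simplex (side_card_eq hd hS)
    (affineIndependent_side hT (Finset.mem_powersetCard.1 hS).1)).2.2 f

open scoped Classical in
theorem powersetCard_eq_image_erase (hc : T.card = d + 1) :
    T.powersetCard d = T.image T.erase := by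
  ext S
  rw [Finset.mem_powersetCard, Finset.mem_image]
  constructor
  · rintro ⟨hST, hS⟩
    obtain ⟨p, hp, hpS⟩ := Finset.exists_mem_notMem_of_card_lt_card (s := S) (t := T) (by omega)
    refine ⟨p, hp, (Finset.eq_of_subset_of_card_le (Finset.subset_erase.2 ⟨hST, hpS⟩) ?_).symm⟩
    rw [Finset.card_erase_of_mem hp]; omega
  · rintro ⟨p, hp, rfl⟩
    exact ⟨Finset.erase_subset _ _, by rw [Finset.card_erase_of_mem hp]; omega⟩

open scoped Classical in
/-- The outer normal has a positive component `h`, the height of the simplex, in the direction from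
the opposite vertex to each point of the side; the height determines the volume. -/
theorem exists_height (hd : 1 ≤ d) (hc : T.card = d + 1)
    (hT : AffineIndependent ℝ ((↑) : T → Pt d)) {p : Pt d} (hp : p ∈ T) :
    ∃ h : ℝ, 0 < h ∧ (∀ s ∈ hull (T.erase p), ⟪s - p, outerNormal T (T.erase p)⟫ = h) ∧
      d * volume.real (hull T) = h * (surface d).real (hull (T.erase p)) := by
  set S := T.erase p with hSdef
  have hS : S ∈ T.powersetCard d := by
    rw [powersetCard_eq_image_erase hc]; exact Finset.mem_image_of_mem _ hp
  have hScard : S.card = d := (Finset.mem_powersetCard.1 hS).2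
  have hSne : S.Nonempty := Finset.card_pos.1 (by omega)
  have hTins : T = insert p S := (Finset.insert_erase hp).symm
  set D := vectorSpan ℝ (S : Set (Pt d)) with hD
  set w : Pt d := Dᗮ.starProjection (S.centroid ℝ id - T.centroid ℝ id) with hw
  have hn : outerNormal T S = ‖w‖⁻¹ • w := rfl
  -- The barycentre difference defining the normal is a positive multiple of the vector from the
  -- opposite vertex p to the side's barycentre; hence the normal points away from p, and the height
  -- is d + 1 times the length of w.
  have hcent : S.centroid ℝ id - T.centroid ℝ id
      = ((d : ℝ) + 1)⁻¹ • (S.centroid ℝ id - p) := by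
    have hpS : p ∉ S := Finset.notMem_erase _ _
    rw [centroid_eq_smul_sum ⟨p, hp⟩, hc, hTins, Finset.sum_insert hpS]
    have : ∑ s ∈ S, s = (d : ℝ) • S.centroid ℝ id := by
      rw [centroid_eq_smul_sum hSne, hScard, smul_smul, mul_inv_cancel₀ (by positivity), one_smul]
    rw [this]
    have hd1 : ((d : ℝ) + 1) ≠ 0 := by positivity
    push_cast
    match_scalars <;> field_simp
    ring
  have hspan : ∀ s ∈ hull S, s ∈ affineSpan ℝ (S : Set (Pt d)) := fun s hs =>
    convexHull_subset_affineSpan _ hs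
  have hproj : ∀ s ∈ hull S, Dᗮ.starProjection (s - p) = ((d : ℝ) + 1) • w := by
    intro s hs
    have h1 : Dᗮ.starProjection (s - S.centroid ℝ id) = 0 := by
      rw [Submodule.starProjection_apply_eq_zero_iff, Submodule.orthogonal_orthogonal,
        hD, ← direction_affineSpan]
      exact AffineSubspace.vsub_mem_direction (hspan s hs) (hspan _ (centroid_mem_hull hSne))
    have h2 : s - p = (s - S.centroid ℝ id) + ((d : ℝ) + 1) • (S.centroid ℝ id - T.centroid ℝ id) := by
      rw [hcent, smul_smul, mul_inv_cancel₀ (by positivity), one_smul]; abel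
    rw [h2, map_add, h1, map_smul, zero_add]
  -- Otherwise p would lie in the affine span of the opposite side, against affine independence.
  have hw0 : w ≠ 0 := by
    intro h0
    obtain ⟨s, hs⟩ := hSne
    have h1 := hproj s (subset_hull hs)
    rw [h0, smul_zero, Submodule.starProjection_apply_eq_zero_iff,
      Submodule.orthogonal_orthogonal, hD, ← direction_affineSpan] at h1
    have h2 : p ∈ affineSpan ℝ (S : Set (Pt d)) := by
      have := AffineSubspace.vadd_mem_of_mem_direction (neg_mem h1)
        (hspan s (subset_hull hs))
      simpa using this
    refine hT.notMem_affineSpan_sdiff ⟨p, hp⟩ Set.univ ?_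
    convert h2 using 2
    ext x
    simp [hSdef, and_comm]
  have hwn : 0 < ‖w‖ := norm_pos_iff.2 hw0
  have hinner : ∀ s ∈ hull S, ⟪s - p, outerNormal T S⟫ = ((d : ℝ) + 1) * ‖w‖ := by
    intro s hs
    have h1 : ⟪s - p, w⟫ = ⟪Dᗮ.starProjection (s - p), w⟫ := by
      rw [Submodule.inner_starProjection_left_eq_right,
        Submodule.starProjection_eq_self_iff.2 (Submodule.starProjection_apply_mem _ _)]
    rw [hn, inner_smul_right, h1, hproj s hs, inner_smul_left, real_inner_self_eq_norm_sq]
    simp only [conj_trivial]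
    field_simp
  refine ⟨((d : ℝ) + 1) * ‖w‖, by positivity, hinner, ?_⟩
  set h := ((d : ℝ) + 1) * ‖w‖ with hh
  have hnn : ‖outerNormal T S‖ = 1 := by
    rw [hn, norm_smul, norm_inv, norm_norm, inv_mul_cancel₀ hwn.ne']
  have hv : ‖h • outerNormal T S‖ = h := by
    rw [norm_smul, hnn, mul_one, Real.norm_of_nonneg (by positivity)]
  have hfin := surface_hull_ne_top hd hT hS
  have hpyr := volume_convexJoin_singleton (K := hull S) (p := p) (v := h • outerNormal T S)
    (isCompact_hull S) (by rw [← norm_pos_iff, hv]; positivity)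
    (fun s hs => by rw [inner_smul_right, hinner s hs, hv, sq])
    (by rw [finrank_euclideanSpace_fin]; exact hfin)
  rw [finrank_euclideanSpace_fin, hv] at hpyr
  have hhull : hull T = convexJoin ℝ {p} (hull S) := by
    rw [hull, hull, ← convexHull_insert (by exact_mod_cast hSne), hTins, Finset.coe_insert]
  rw [hhull]
  exact hpyr

open scoped Classical in
theorem erase_mem_powersetCard (hc : T.card = d + 1) {p : Pt d} (hp : p ∈ T) :
    T.erase p ∈ T.powersetCard d := by
  rw [powersetCard_eq_image_erase hc]; exact Finset.mem_image_of_mem _ hp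

theorem inner_sub_outerNormal_eq_zero (hd : 1 ≤ d) (hc : T.card = d + 1)
    (hT : AffineIndependent ℝ ((↑) : T → Pt d)) {S : Finset (Pt d)} (hS : S ∈ T.powersetCard d)
    {s s' : Pt d} (hs : s ∈ hull S) (hs' : s' ∈ hull S) : ⟪s - s', outerNormal T S⟫ = 0 := by
  classical
  rw [powersetCard_eq_image_erase hc, Finset.mem_image] at hS
  obtain ⟨p, hp, rfl⟩ := hS
  obtain ⟨h, -, hh, -⟩ := exists_height hd hc hT hp
  have : s - s' = (s - p) - (s' - p) := by abel
  rw [this, inner_sub_left, hh s hs, hh s' hs', sub_self]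

open scoped Classical in
/-- The normals of the sides containing a given vertex span the space. -/
theorem eq_zero_of_inner_outerNormal (hd : 1 ≤ d) (hc : T.card = d + 1)
    (hT : AffineIndependent ℝ ((↑) : T → Pt d)) {q : Pt d} (hq : q ∈ T) {a : Pt d}
    (ha : ∀ p ∈ T, p ≠ q → ⟪a, outerNormal T (T.erase p)⟫ = 0) : a = 0 := by
  set b := elemBasis hc hT
  -- Expand a in the edges issuing from q. The normal opposite p annihilates every edge but p - q,
  -- so each hypothesis on a kills one coefficient.
  have hsum : a = ∑ t : T, b.coord t (q + a) • ((t : Pt d) - q) := by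
    simp only [smul_sub, Finset.sum_sub_distrib, ← Finset.sum_smul, b.sum_coord_apply_eq_one,
      one_smul]
    have := b.linear_combination_coord_eq_self (q + a)
    simp only [b, elemBasis_apply] at this
    rw [this]; abel
  have hcoord : ∀ p : T, (p : Pt d) ≠ q → b.coord p (q + a) = 0 := by
    intro p hpq
    obtain ⟨h, hpos, hh, -⟩ := exists_height hd hc hT p.2
    have h0 := ha p p.2 hpq
    rw [hsum, sum_inner, Finset.sum_eq_single p] at h0
    · have h1 := hh q (subset_hull (Finset.mem_erase.2 ⟨hpq.symm, hq⟩))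
      rw [inner_smul_left, ← neg_sub, inner_neg_left, h1] at h0
      simpa [hpos.ne'] using h0
    · intro t _ htp
      rw [inner_smul_left, inner_sub_outerNormal_eq_zero hd hc hT (erase_mem_powersetCard hc p.2)
        (subset_hull (Finset.mem_erase.2 ⟨fun h => htp (Subtype.ext h), t.2⟩))
        (subset_hull (Finset.mem_erase.2 ⟨hpq.symm, hq⟩)), mul_zero]
    · simp
  rw [hsum]
  refine Finset.sum_eq_zero fun t _ => ?_
  by_cases ht : (t : Pt d) = q
  · rw [ht, sub_self, smul_zero]
  · rw [hcoord t ht, zero_smul]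

/-- There is an affine field whose normal component is one on a given side and vanishes on the other
sides. -/
theorem exists_sideField (hd : 1 ≤ d) (hc : T.card = d + 1)
    (hT : AffineIndependent ℝ ((↑) : T → Pt d)) {S : Finset (Pt d)} (hS : S ∈ T.powersetCard d) :
    ∃ y : Pt d →ᵃ[ℝ] Pt d, (∀ x ∈ hull S, ⟪y x, outerNormal T S⟫ = 1) ∧
      ∀ S' ∈ T.powersetCard d, S' ≠ S → ∀ x ∈ hull S', ⟪y x, outerNormal T S'⟫ = 0 := by
  classical
  have hS0 := hS
  rw [powersetCard_eq_image_erase hc, Finset.mem_image] at hS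
  obtain ⟨p, hp, rfl⟩ := hS
  obtain ⟨h, hpos, hh, -⟩ := exists_height hd hc hT hp
  -- The field x - p is tangential to every side through p and has normal component equal to the
  -- height on the opposite side.
  refine ⟨h⁻¹ • (AffineMap.id ℝ (Pt d) - AffineMap.const ℝ (Pt d) p), ?_, ?_⟩
  · intro x hx
    have : (h⁻¹ • (AffineMap.id ℝ (Pt d) - AffineMap.const ℝ (Pt d) p)) x = h⁻¹ • (x - p) := rfl
    rw [this, inner_smul_left, hh x hx]
    simp [hpos.ne']
  · intro S' hS' hne x hx
    have : (h⁻¹ • (AffineMap.id ℝ (Pt d) - AffineMap.const ℝ (Pt d) p)) x = h⁻¹ • (x - p) := rfl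
    have hpS' : p ∈ hull S' := by
      have hS'2 := hS'
      rw [powersetCard_eq_image_erase hc, Finset.mem_image] at hS'2
      obtain ⟨q, hq, rfl⟩ := hS'2
      exact subset_hull (Finset.mem_erase.2 ⟨fun h => hne (h ▸ rfl), hp⟩)
    rw [this, inner_smul_left, inner_sub_outerNormal_eq_zero hd hc hT hS' hx hpS', mul_zero]

open scoped Classical in
/-- An affine field with constant normal component on each side is a combination of the fields
`x ↦ x - p`, where `p` is a vertex. -/
theorem affineField_eq_sum (hd : 1 ≤ d) (hc : T.card = d + 1)
    (hT : AffineIndependent ℝ ((↑) : T → Pt d)) {y : Pt d →ᵃ[ℝ] Pt d} {h c : Pt d → ℝ}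
    (hpos : ∀ p ∈ T, 0 < h p)
    (hh : ∀ p ∈ T, ∀ s ∈ hull (T.erase p), ⟪s - p, outerNormal T (T.erase p)⟫ = h p)
    (hy : ∀ p ∈ T, ∀ x ∈ hull (T.erase p), ⟪y x, outerNormal T (T.erase p)⟫ = c p) :
    y = ∑ p ∈ T, (c p / h p) • (AffineMap.id ℝ (Pt d) - AffineMap.const ℝ (Pt d) p) := by
  set R := ∑ p ∈ T, (c p / h p) • (AffineMap.id ℝ (Pt d) - AffineMap.const ℝ (Pt d) p) with hR
  have hRx : ∀ x, R x = ∑ p ∈ T, (c p / h p) • (x - p) := by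
    intro x
    rw [hR, affineMap_sum_apply]
    rfl
  rw [← sub_eq_zero]
  ext1 x
  rw [affineMap_eq_sum_coord (elemBasis hc hT) (y - R) x]
  refine Finset.sum_eq_zero fun q _ => ?_
  -- An affine map is determined by its vertex values. At the vertex q the normal components of y
  -- and R agree on all sides through q, and those normals span.
  suffices (y - R) (elemBasis hc hT q) = 0 by rw [this, smul_zero]
  refine eq_zero_of_inner_outerNormal hd hc hT q.2 fun p hp hpq => ?_
  have hqp : (q : Pt d) ∈ hull (T.erase p) := subset_hull (Finset.mem_erase.2 ⟨hpq.symm, q.2⟩)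
  have : (y - R) (elemBasis hc hT q) = y q - R q := rfl
  rw [this, inner_sub_left, hy p hp _ hqp, hRx, sum_inner, Finset.sum_eq_single p]
  · rw [inner_smul_left, hh p hp _ hqp]
    simp [(hpos p hp).ne']
  · intro r hr hrp
    rw [inner_smul_left, inner_sub_outerNormal_eq_zero hd hc hT (erase_mem_powersetCard hc hp) hqp
      (subset_hull (Finset.mem_erase.2 ⟨hrp, hr⟩)), mul_zero]
  · exact fun h => absurd hp h

theorem inner_affineGrad (v : Pt d →ᵃ[ℝ] ℝ) (x : Pt d) : ⟪affineGrad v, x⟫ = v.linear x := by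
  rw [affineGrad, InnerProductSpace.toDual_symm_apply]
  rfl

/-- Integration by parts on a simplex, for an affine function and a field with constant normal
component on each side. -/
theorem green_element (hd : 1 ≤ d) (hc : T.card = d + 1)
    (hT : AffineIndependent ℝ ((↑) : T → Pt d)) (v : Pt d →ᵃ[ℝ] ℝ) {y : Pt d →ᵃ[ℝ] Pt d}
    (hy : ∀ S ∈ T.powersetCard d, ∃ c : ℝ, ∀ x ∈ hull S, ⟪y x, outerNormal T S⟫ = c) :
    volume.real (hull T) * (⟪affineGrad v, y (T.centroid ℝ id)⟫
        + v (T.centroid ℝ id) * affineDiv y)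
      = ∑ S ∈ T.powersetCard d, (surface d).real (hull S)
          * ⟪y (S.centroid ℝ id), outerNormal T S⟫ * v (S.centroid ℝ id) := by
  classical
  have hex : ∀ p : Pt d, ∃ h c : ℝ, p ∈ T → 0 < h ∧
      (∀ s ∈ hull (T.erase p), ⟪s - p, outerNormal T (T.erase p)⟫ = h) ∧
      d * volume.real (hull T) = h * (surface d).real (hull (T.erase p)) ∧
      ∀ x ∈ hull (T.erase p), ⟪y x, outerNormal T (T.erase p)⟫ = c := by
    intro p
    by_cases hp : p ∈ T
    · obtain ⟨h, h1, h2, h3⟩ := exists_height hd hc hT hp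
      obtain ⟨c, hcc⟩ := hy _ (erase_mem_powersetCard hc hp)
      exact ⟨h, c, fun _ => ⟨h1, h2, h3, hcc⟩⟩
    · exact ⟨0, 0, fun h => absurd h hp⟩
  choose h c hhc using hex
  have hyR := affineField_eq_sum hd hc hT (fun p hp => (hhc p hp).1) (fun p hp => (hhc p hp).2.1)
    (fun p hp => (hhc p hp).2.2.2)
  have hTne : T.Nonempty := Finset.card_pos.1 (by omega)
  set bT := T.centroid ℝ id
  have hdiv : affineDiv y = ∑ p ∈ T, c p / h p * d := by
    rw [affineDiv, hyR, affineMap_sum_linear, map_sum]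
    refine Finset.sum_congr rfl fun p _ => ?_
    simp
  have hyb : y bT = ∑ p ∈ T, (c p / h p) • (bT - p) := by
    conv_lhs => rw [hyR, affineMap_sum_apply]
    rfl
  have hvS : ∀ p ∈ T, (d : ℝ) * v ((T.erase p).centroid ℝ id) = (d + 1) * v bT - v p := by
    intro p hp
    have hcard : (T.erase p).card = d := by rw [Finset.card_erase_of_mem hp]; omega
    have hd0 : (d : ℝ) ≠ 0 := by positivity
    have hd1 : (d : ℝ) + 1 ≠ 0 := by positivity
    rw [affineMap_finset_centroid (Finset.card_pos.1 (by omega)), affineMap_finset_centroid hTne,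
      hcard, hc, ← Finset.add_sum_erase T v hp]
    push_cast
    simp only [smul_eq_mul]
    rw [mul_inv_cancel_left₀ hd0, mul_inv_cancel_left₀ hd1]
    ring
  rw [powersetCard_eq_image_erase hc, Finset.sum_image (Finset.erase_injOn T), hdiv, hyb,
    inner_sum, Finset.mul_sum, ← Finset.sum_add_distrib, Finset.mul_sum]
  refine Finset.sum_congr rfl fun p hp => ?_
  obtain ⟨h1, h2, h3, h4⟩ := hhc p hp
  have hne : (T.erase p).Nonempty :=
    Finset.card_pos.1 (by rw [Finset.card_erase_of_mem hp]; omega)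
  have hlin : v.linear (bT - p) = v bT - v p := v.linearMap_vsub bT p
  rw [h4 _ (centroid_mem_hull hne), inner_smul_right, inner_affineGrad, hlin]
  have h5 : (surface d).real (hull (T.erase p)) = d * volume.real (hull T) / h p := by
    rw [h3]; field_simp
  have h6 := hvS p hp
  rw [h5]
  -- Both sides of Green's formula are linear in y, leaving the field x - p: its divergence is d,
  -- the gradient term is v(bT) - v(p), and the area of the opposite side is d times the volume over
  -- the height.
  have : v bT + v bT * d - v p = d * v ((T.erase p).centroid ℝ id) := by rw [h6]; ring
  linear_combination (volume.real (hull T) * (c p / h p)) * this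

end Element
end OptimalInsulation

namespace OptimalInsulation

/-! ### Barycentric coordinates relative to an element -/

section Coordinates

open scoped Topology

variable {d : ℕ} {T : Finset (Pt d)}

theorem mem_hull_iff_coord (hc : T.card = d + 1) (hT : AffineIndependent ℝ ((↑) : T → Pt d))
    {x : Pt d} : x ∈ hull T ↔ ∀ t, 0 ≤ (elemBasis hc hT).coord t x := by
  rw [hull_eq_convexHull_range hc hT, AffineBasis.convexHull_eq_nonneg_coord]
  rfl

theorem coord_vertex_ne (hc : T.card = d + 1) (hT : AffineIndependent ℝ ((↑) : T → Pt d))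
    (t : T) {s : Pt d} (hs : s ∈ T) (hst : s ≠ t) : (elemBasis hc hT).coord t s = 0 :=
  (elemBasis hc hT).coord_apply_ne (i := t) (j := ⟨s, hs⟩) fun h => hst (by rw [h])

theorem coord_vertex_self (hc : T.card = d + 1) (hT : AffineIndependent ℝ ((↑) : T → Pt d))
    (t : T) : (elemBasis hc hT).coord t t = 1 :=
  (elemBasis hc hT).coord_apply_eq t

theorem coord_eq_zero_of_mem_convexHull (hc : T.card = d + 1)
    (hT : AffineIndependent ℝ ((↑) : T → Pt d)) {A : Set (Pt d)} (hA : A ⊆ T) {t : T}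
    (ht : (t : Pt d) ∉ A) {x : Pt d} (hx : x ∈ convexHull ℝ A) :
    (elemBasis hc hT).coord t x = 0 := by
  have hconv : Convex ℝ ((elemBasis hc hT).coord t ⁻¹' {0}) :=
    (convex_singleton (0 : ℝ)).affine_preimage _
  refine convexHull_min (fun a ha => ?_) hconv hx
  exact coord_vertex_ne hc hT t (hA ha) fun h => ht (h ▸ ha)

theorem coord_centroid_pos (hc : T.card = d + 1) (hT : AffineIndependent ℝ ((↑) : T → Pt d))
    {S : Finset (Pt d)} (hS : S ⊆ T) {t : T} (ht : (t : Pt d) ∈ S) :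
    0 < (elemBasis hc hT).coord t (S.centroid ℝ id) := by
  rw [affineMap_finset_centroid ⟨_, ht⟩, smul_eq_mul]
  refine mul_pos (inv_pos.2 (by exact_mod_cast Finset.card_pos.2 ⟨_, ht⟩)) ?_
  rw [Finset.sum_eq_single_of_mem _ ht
    fun s hs hst => coord_vertex_ne hc hT t (hS hs) hst, coord_vertex_self]
  exact one_pos

theorem coord_lineMap (hc : T.card = d + 1) (hT : AffineIndependent ℝ ((↑) : T → Pt d))
    (t : T) (x y : Pt d) (ε : ℝ) : (elemBasis hc hT).coord t (AffineMap.lineMap x y ε)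
      = (1 - ε) * (elemBasis hc hT).coord t x + ε * (elemBasis hc hT).coord t y := by
  rw [AffineMap.apply_lineMap, AffineMap.lineMap_apply_module]
  rfl

theorem eventually_coord_pos (hc : T.card = d + 1) (hT : AffineIndependent ℝ ((↑) : T → Pt d))
    {S : Finset (Pt d)} (hS : S ⊆ T) :
    ∀ᶠ x in 𝓝 (S.centroid ℝ id), ∀ t : T, (t : Pt d) ∈ S → 0 < (elemBasis hc hT).coord t x := by
  rw [Filter.eventually_all]
  intro t
  by_cases ht : (t : Pt d) ∈ S
  · simp only [ht, forall_const]
    exact (continuous_barycentric_coord (elemBasis hc hT) t).continuousAt.eventually_const_lt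
      (coord_centroid_pos hc hT hS ht)
  · simp [ht]

end Coordinates

/-! ### Interior sides, boundary sides and the topological boundary -/

namespace Triangulation

open scoped Topology

variable {d : ℕ} (𝒯 : Triangulation d)

theorem mem_sides {S : Finset (Pt d)} : S ∈ 𝒯.sides ↔ ∃ T ∈ 𝒯.elems, S ∈ T.powersetCard d := by
  simp [sides]

theorem mem_adjacent {S : Finset (Pt d)} {T : 𝒯.elems} : T ∈ 𝒯.adjacent S ↔ S ⊆ T.1 := by
  simp [adjacent]

theorem interiorSides_subset_sides {S : Finset (Pt d)} (hS : S ∈ 𝒯.interiorSides) :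
    S ∈ 𝒯.sides := (Finset.mem_filter.1 hS).1

open scoped Classical in
theorem boundarySides_subset_sides {S : Finset (Pt d)} (hS : S ∈ 𝒯.boundarySides) :
    S ∈ 𝒯.sides := (Finset.mem_filter.1 hS).1

theorem card_of_mem_sides {S : Finset (Pt d)} (hS : S ∈ 𝒯.sides) : S.card = d := by
  obtain ⟨T, -, h⟩ := 𝒯.mem_sides.1 hS
  exact (Finset.mem_powersetCard.1 h).2

theorem mem_powersetCard_of_adjacent {S : Finset (Pt d)} (hS : S ∈ 𝒯.sides) {T : 𝒯.elems}
    (hT : T ∈ 𝒯.adjacent S) : S ∈ T.1.powersetCard d :=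
  Finset.mem_powersetCard.2 ⟨𝒯.mem_adjacent.1 hT, 𝒯.card_of_mem_sides hS⟩

theorem adjacent_nonempty {S : Finset (Pt d)} (hS : S ∈ 𝒯.sides) : (𝒯.adjacent S).Nonempty := by
  obtain ⟨T, hT, h⟩ := 𝒯.mem_sides.1 hS
  exact ⟨⟨T, hT⟩, 𝒯.mem_adjacent.2 (Finset.mem_powersetCard.1 h).1⟩

/-- Two different sets of d + 1 vertices share at most d of them, so the common side S is the whole
intersection. -/
theorem mem_interiorSides_of_subset {S T T' : Finset (Pt d)} (hS : S ∈ 𝒯.sides)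
    (hT : T ∈ 𝒯.elems) (hT' : T' ∈ 𝒯.elems) (hne : T ≠ T') (h : S ⊆ T) (h' : S ⊆ T') :
    S ∈ 𝒯.interiorSides := by
  classical
  have hc := 𝒯.card_elem T hT
  have hc' := 𝒯.card_elem T' hT'
  have hlt : (T ∩ T').card < T.card := by
    refine Finset.card_lt_card ⟨Finset.inter_subset_left, fun hsub => hne ?_⟩
    exact Finset.eq_of_subset_of_card_le (fun x hx => (Finset.mem_inter.1 (hsub hx)).2) (by omega)
  have hSeq : S = T ∩ T' := Finset.eq_of_subset_of_card_le (Finset.subset_inter h h')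
    (by rw [𝒯.card_of_mem_sides hS]; omega)
  refine Finset.mem_filter.2 ⟨hS, T, hT, T', hT', hne, ?_⟩
  rw [hSeq, Finset.coe_inter]

theorem eq_of_mem_adjacent {S : Finset (Pt d)} (hS : S ∈ 𝒯.sides) (hSi : S ∉ 𝒯.interiorSides)
    {T T' : 𝒯.elems} (hT : T ∈ 𝒯.adjacent S) (hT' : T' ∈ 𝒯.adjacent S) : T = T' := by
  by_contra hne
  exact hSi (𝒯.mem_interiorSides_of_subset hS T.2 T'.2 (fun h => hne (Subtype.ext h))
    (𝒯.mem_adjacent.1 hT) (𝒯.mem_adjacent.1 hT'))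

/-- The closed mesh elements cover a neighbourhood of the barycentre of an interior side. -/
theorem centroid_mem_domain (hd : 1 ≤ d) {S : Finset (Pt d)} (hS : S ∈ 𝒯.interiorSides) :
    S.centroid ℝ id ∈ 𝒯.domain := by
  classical
  have hSs := 𝒯.interiorSides_subset_sides hS
  have hcard := 𝒯.card_of_mem_sides hSs
  obtain ⟨-, T, hTe, T', hTe', hne, hST⟩ := Finset.mem_filter.1 hS
  have hST1 : S ⊆ T := fun x hx =>
    ((Set.ext_iff.1 hST x).1 hx).1
  have hST2 : S ⊆ T' := fun x hx => ((Set.ext_iff.1 hST x).1 hx).2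
  have hc := 𝒯.card_elem T hTe
  have hc' := 𝒯.card_elem T' hTe'
  have hT := 𝒯.affineIndependent T hTe
  have hT' := 𝒯.affineIndependent T' hTe'
  have hSm : S ∈ T.powersetCard d := Finset.mem_powersetCard.2 ⟨hST1, hcard⟩
  have hSm' : S ∈ T'.powersetCard d := Finset.mem_powersetCard.2 ⟨hST2, hcard⟩
  rw [powersetCard_eq_image_erase hc, Finset.mem_image] at hSm
  rw [powersetCard_eq_image_erase hc', Finset.mem_image] at hSm'
  obtain ⟨p, hp, hpS⟩ := hSm
  obtain ⟨p', hp', hpS'⟩ := hSm'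
  have hpnS : p ∉ S := hpS ▸ Finset.notMem_erase _ _
  have hpnS' : p' ∉ S := hpS' ▸ Finset.notMem_erase _ _
  have hmem : ∀ t ∈ T, t ≠ p → t ∈ S := fun t ht h => hpS ▸ Finset.mem_erase.2 ⟨h, ht⟩
  have hmem' : ∀ t ∈ T', t ≠ p' → t ∈ S := fun t ht h => hpS' ▸ Finset.mem_erase.2 ⟨h, ht⟩
  set b := elemBasis hc hT with hb
  set b' := elemBasis hc' hT' with hb'
  set κ := b'.coord ⟨p', hp'⟩ p with hκ
  -- Both coordinates vanish on the hyperplane spanned by S, hence they are proportional.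
  have hprop : ∀ x, b'.coord ⟨p', hp'⟩ x = b.coord ⟨p, hp⟩ x * κ := by
    intro x
    rw [affineMap_eq_sum_coord b (b'.coord ⟨p', hp'⟩) x, Finset.sum_eq_single ⟨p, hp⟩]
    · rfl
    · intro t _ htp
      have htS := hmem t t.2 fun h => htp (Subtype.ext h)
      have : b'.coord ⟨p', hp'⟩ (b t) = 0 :=
        coord_vertex_ne hc' hT' ⟨p', hp'⟩ (hST2 htS) fun h => hpnS' ((show (t : Pt d) = p' from h) ▸ htS)
      rw [this, smul_zero]
    · simp
  have hev := eventually_coord_pos hc hT hST1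
  have hev' := eventually_coord_pos hc' hT' hST2
  have hin : ∀ x, (∀ t : T, (t : Pt d) ∈ S → 0 < b.coord t x) → 0 ≤ b.coord ⟨p, hp⟩ x →
      x ∈ hull T := by
    intro x hx h0
    refine (mem_hull_iff_coord hc hT).2 fun t => ?_
    by_cases htp : t = ⟨p, hp⟩
    · rw [htp]; exact h0
    · exact (hx t (hmem t t.2 fun h => htp (Subtype.ext h))).le
  have hin' : ∀ x, (∀ t : T', (t : Pt d) ∈ S → 0 < b'.coord t x) → 0 ≤ b'.coord ⟨p', hp'⟩ x →
      x ∈ hull T' := by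
    intro x hx h0
    refine (mem_hull_iff_coord hc' hT').2 fun t => ?_
    by_cases htp : t = ⟨p', hp'⟩
    · rw [htp]; exact h0
    · exact (hx t (hmem' t t.2 fun h => htp (Subtype.ext h))).le
  -- The elements lie on opposite sides of S: if κ > 0, a small move from the barycentre of S
  -- towards p stays in both elements but leaves S, against conformity. Near the barycentre the sign
  -- of the coordinate of p then decides which element contains a point.
  have hκ0 : κ ≤ 0 := by
    by_contra! hpos
    have hline : Filter.Tendsto (AffineMap.lineMap (k := ℝ) (S.centroid ℝ id) p) (𝓝[>] 0)
        (𝓝 (S.centroid ℝ id)) := by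
      have h : Continuous (AffineMap.lineMap (k := ℝ) (S.centroid ℝ id) p) :=
        AffineMap.lineMap_continuous
      have := h.tendsto 0
      rw [AffineMap.lineMap_apply_zero] at this
      exact this.mono_left nhdsWithin_le_nhds
    obtain ⟨ε, ⟨hε1, hε2⟩, hε⟩ := ((hline.eventually (hev.and hev')).and
      (self_mem_nhdsWithin : Set.Ioi (0 : ℝ) ∈ 𝓝[>] 0)).exists
    set x := AffineMap.lineMap (k := ℝ) (S.centroid ℝ id) p ε
    have hSne : S.Nonempty := Finset.card_pos.1 (by omega)
    have h0 : b.coord ⟨p, hp⟩ (S.centroid ℝ id) = 0 :=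
      coord_eq_zero_of_mem_convexHull hc hT (A := S) (by exact_mod_cast hST1) hpnS
        (centroid_mem_hull hSne)
    have hxp : 0 < b.coord ⟨p, hp⟩ x := by
      rw [hb, coord_lineMap, ← hb, h0, mul_zero, zero_add]
      exact mul_pos hε (by rw [hb, coord_vertex_self hc hT ⟨p, hp⟩]; exact one_pos)
    have hx1 := hin x hε1 hxp.le
    have hx2 := hin' x hε2 (by rw [hprop]; positivity)
    have hx3 := 𝒯.inter_subset T hTe T' hTe' ⟨hx1, hx2⟩
    rw [← hST] at hx3
    exact hxp.ne' (coord_eq_zero_of_mem_convexHull hc hT (A := S) (by exact_mod_cast hST1) hpnS hx3)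
  rw [domain, mem_interior_iff_mem_nhds]
  filter_upwards [hev, hev'] with x hx hx'
  rcases le_total 0 (b.coord ⟨p, hp⟩ x) with h0 | h0
  · exact Set.mem_biUnion hTe (hin x hx h0)
  · exact Set.mem_biUnion hTe' (hin' x hx' (by rw [hprop]; exact mul_nonneg_of_nonpos_of_nonpos h0 hκ0))

open scoped Classical in
-- The barycentre of an interior side lies in the open domain, so not on its frontier.
theorem notMem_interiorSides_of_mem_boundarySides (hd : 1 ≤ d) {S : Finset (Pt d)}
    (hS : S ∈ 𝒯.boundarySides) : S ∉ 𝒯.interiorSides := by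
  intro hSi
  have hSne : S.Nonempty := Finset.card_pos.1 (by
    rw [𝒯.card_of_mem_sides (𝒯.boundarySides_subset_sides hS)]; omega)
  have h := (Finset.mem_filter.1 hS).2 (centroid_mem_hull hSne)
  have h2 := 𝒯.centroid_mem_domain hd hSi
  rw [frontier, domain, interior_interior] at h
  exact h.2 h2

/-- A side of a single element lies on the boundary of the domain. -/
theorem mem_boundarySides_of_notMem_interiorSides (hd : 1 ≤ d) {S : Finset (Pt d)}
    (hS : S ∈ 𝒯.sides) (hSi : S ∉ 𝒯.interiorSides) : S ∈ 𝒯.boundarySides := by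
  classical
  refine Finset.mem_filter.2 ⟨hS, fun x hx => ?_⟩
  obtain ⟨T, hTe, hSm⟩ := 𝒯.mem_sides.1 hS
  obtain ⟨hST, hcard⟩ := Finset.mem_powersetCard.1 hSm
  have hc := 𝒯.card_elem T hTe
  have hT := 𝒯.affineIndependent T hTe
  rw [powersetCard_eq_image_erase hc, Finset.mem_image] at hSm
  obtain ⟨p, hp, hpS⟩ := hSm
  have hpnS : p ∉ S := hpS ▸ Finset.notMem_erase _ _
  have hSne : S.Nonempty := Finset.card_pos.1 (by omega)
  set b := elemBasis hc hT with hb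
  have hsub : hull T ⊆ ⋃ T ∈ 𝒯.elems, hull T := Set.subset_biUnion_of_mem (u := hull) hTe
  have hST' : hull S ⊆ hull T := convexHull_mono (by exact_mod_cast hST)
  rw [frontier, domain, interior_interior]
  constructor
  · have hne : (interior (hull T)).Nonempty := by
      rw [hull_eq_convexHull_range hc hT]
      exact ⟨_, b.centroid_mem_interior_convexHull⟩
    refine closure_mono (interior_mono hsub) ?_
    rw [(convex_hull T).closure_interior_eq_closure_of_nonempty_interior hne]
    exact subset_closure (hST' hx)
  · intro hxi
    have hcont : ∀ u v : Pt d, Filter.Tendsto (AffineMap.lineMap (k := ℝ) u v) (𝓝 0) (𝓝 u) := by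
      intro u v
      have h : Continuous (AffineMap.lineMap (k := ℝ) u v) := AffineMap.lineMap_continuous
      have := h.tendsto 0
      rwa [AffineMap.lineMap_apply_zero] at this
    have hzero : ∀ y ∈ hull S, b.coord ⟨p, hp⟩ y = 0 := fun y hy =>
      coord_eq_zero_of_mem_convexHull hc hT (A := S) (by exact_mod_cast hST) hpnS hy
    -- Moving x slightly towards the barycentre of S makes all coordinates belonging to S positive
    -- while remaining in the interior of the union.
    obtain ⟨y, hyS, hyi, hypos⟩ : ∃ y ∈ hull S, y ∈ interior (⋃ T ∈ 𝒯.elems, hull T) ∧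
        ∀ t : T, (t : Pt d) ∈ S → 0 < b.coord t y := by
      have h1 := (hcont x (S.centroid ℝ id)).mono_left (nhdsWithin_le_nhds (s := Set.Ioi 0))
      have h2 : ∀ᶠ ε in 𝓝[>] (0 : ℝ), ε ∈ Set.Ioo (0 : ℝ) 1 := Ioo_mem_nhdsGT one_pos
      obtain ⟨ε, h3, h4⟩ := ((h1.eventually (isOpen_interior.mem_nhds hxi)).and h2).exists
      have hcc := centroid_mem_hull hSne
      refine ⟨_, (convex_hull S).lineMap_mem hx hcc ⟨h4.1.le, h4.2.le⟩, h3, fun t ht => ?_⟩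
      rw [hb, coord_lineMap]
      have h5 := (mem_hull_iff_coord hc hT).1 (hST' hx) t
      have h6 := coord_centroid_pos hc hT hST ht
      have := h4.1
      have h7 : 0 ≤ 1 - ε := by linarith [h4.2]
      positivity
    -- Negative parameters on the line from y to p lead out of T, into other elements. Their finite
    -- union is closed, so it contains y; by conformity and positivity of the coordinates, one of
    -- them then has all of S among its vertices.
    have hyX : y ∈ ⋃ T' ∈ 𝒯.elems.erase T, hull T' := by
      have hclosed : IsClosed (⋃ T' ∈ 𝒯.elems.erase T, hull T') :=
        (Finset.finite_toSet _).isClosed_biUnion fun T' _ => (isCompact_hull T').isClosed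
      refine hclosed.mem_of_tendsto
        ((hcont y p).mono_left (nhdsWithin_le_nhds (s := Set.Iio 0))) ?_
      filter_upwards [((hcont y p).mono_left (nhdsWithin_le_nhds (s := Set.Iio 0))).eventually
        (isOpen_interior.mem_nhds hyi), self_mem_nhdsWithin] with δ hδ hδ0
      have hδX := interior_subset hδ
      simp only [Set.mem_iUnion] at hδX ⊢
      obtain ⟨T', hT'e, hδT'⟩ := hδX
      refine ⟨T', Finset.mem_erase.2 ⟨?_, hT'e⟩, hδT'⟩
      rintro rfl
      have := (mem_hull_iff_coord hc hT).1 hδT' ⟨p, hp⟩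
      rw [coord_lineMap, ← hb, hzero y hyS, mul_zero, zero_add, hb,
        coord_vertex_self hc hT ⟨p, hp⟩, mul_one] at this
      exact absurd this (not_le.2 hδ0)
    simp only [Set.mem_iUnion] at hyX
    obtain ⟨T', hT'e, hyT'⟩ := hyX
    obtain ⟨hne, hT'e⟩ := Finset.mem_erase.1 hT'e
    have hy2 := 𝒯.inter_subset T hTe T' hT'e ⟨hST' hyS, hyT'⟩
    refine hSi (𝒯.mem_interiorSides_of_subset hS hTe hT'e hne.symm hST fun s hs => ?_)
    by_contra hsT'
    have := coord_eq_zero_of_mem_convexHull hc hT (t := ⟨s, hST hs⟩) Set.inter_subset_left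
      (fun h => hsT' h.2) hy2
    exact (hypos ⟨s, hST hs⟩ hs).ne' this

end Triangulation
end OptimalInsulation

namespace OptimalInsulation
-- Reduction to barycentre values and discrete integration by parts
namespace Triangulation

variable {d : ℕ} (𝒯 : Triangulation d)

theorem innerL0_eq (a b : 𝒯.L0) :
    𝒯.innerL0 a b = ∑ T : 𝒯.elems, volume.real (hull T.1) * (a T * b T) := by
  simp [innerL0]

theorem innerL0Vec_eq (a b : 𝒯.L0Vec) :
    𝒯.innerL0Vec a b = ∑ T : 𝒯.elems, volume.real (hull T.1) * ⟪a T, b T⟫ := by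
  simp [innerL0Vec]

theorem proj_eq (v : 𝒯.L1) (T : 𝒯.elems) : 𝒯.proj v T = v T (T.1.centroid ℝ id) :=
  elemMean_affineMap (𝒯.card_elem T T.2) (𝒯.affineIndependent T T.2) (v T)

theorem projVec_eq (y : 𝒯.L1Vec) (T : 𝒯.elems) : 𝒯.projVec y T = y T (T.1.centroid ℝ id) :=
  elemMean_affineMap (𝒯.card_elem T T.2) (𝒯.affineIndependent T T.2) (y T)

theorem sideIntegral_const (S : Finset (Pt d)) (c : ℝ) :
    sideIntegral S (fun _ => c) = (surface d).real (hull S) * c := by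
  simp [sideIntegral]

theorem area_pos (hd : 1 ≤ d) {S : Finset (Pt d)} (hS : S ∈ 𝒯.sides) :
    0 < (surface d).real (hull S) := by
  obtain ⟨T, hT, h⟩ := 𝒯.mem_sides.1 hS
  exact surface_hull_pos hd (𝒯.affineIndependent T hT) h

theorem sideMean_affineMap_of_mem_sides (hd : 1 ≤ d) {S : Finset (Pt d)} (hS : S ∈ 𝒯.sides)
    (f : Pt d →ᵃ[ℝ] ℝ) : sideMean S f = f (S.centroid ℝ id) := by
  obtain ⟨T, hT, h⟩ := 𝒯.mem_sides.1 hS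
  exact sideMean_affineMap hd (𝒯.affineIndependent T hT) h f

theorem traceMean_eq (hd : 1 ≤ d) {S : Finset (Pt d)} (hS : S ∈ 𝒯.sides) (v : 𝒯.L1) :
    𝒯.traceMean v S = ∑ T ∈ 𝒯.adjacent S, v T (S.centroid ℝ id) := by
  have h : 𝒯.trace v S = (∑ T ∈ 𝒯.adjacent S, v T : Pt d →ᵃ[ℝ] ℝ) := by
    funext x
    rw [affineMap_sum_apply]
    rfl
  rw [traceMean, h, 𝒯.sideMean_affineMap_of_mem_sides hd hS, affineMap_sum_apply]

/-- The jump is affine, so its mean over a side is its value at the barycentre. -/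
theorem mem_CR_iff (hd : 1 ≤ d) {v : 𝒯.L1} : v ∈ 𝒯.CR ↔ ∀ S ∈ 𝒯.interiorSides,
    ∀ T ∈ 𝒯.adjacent S, ∀ T' ∈ 𝒯.adjacent S, v T (S.centroid ℝ id) = v T' (S.centroid ℝ id) := by
  have key : ∀ S ∈ 𝒯.interiorSides, ∀ T T' : 𝒯.elems, sideMean S (fun x => v T x - v T' x)
      = v T (S.centroid ℝ id) - v T' (S.centroid ℝ id) := fun S hS T T' =>
    𝒯.sideMean_affineMap_of_mem_sides hd (𝒯.interiorSides_subset_sides hS) (v T - v T')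
  constructor
  · intro h S hS T hT T' hT'
    have := h S hS T hT T' hT'
    rwa [key S hS, sub_eq_zero] at this
  · intro h S hS T hT T' hT'
    rw [key S hS, sub_eq_zero]
    exact h S hS T hT T' hT'

theorem nonempty_of_mem_sides (hd : 1 ≤ d) {S : Finset (Pt d)} (hS : S ∈ 𝒯.sides) :
    S.Nonempty := Finset.card_pos.1 (by rw [𝒯.card_of_mem_sides hS]; omega)

theorem centroid_mem_hull_of_mem_sides (hd : 1 ≤ d) {S : Finset (Pt d)} (hS : S ∈ 𝒯.sides) :
    S.centroid ℝ id ∈ hull S := centroid_mem_hull (𝒯.nonempty_of_mem_sides hd hS)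

theorem normalJump_eq_centroid (hd : 1 ≤ d) {y : 𝒯.L1Vec} (hy : y ∈ 𝒯.RT) {S : Finset (Pt d)}
    (hS : S ∈ 𝒯.sides) {x : Pt d} (hx : x ∈ hull S) :
    𝒯.normalJump y S x = 𝒯.normalJump y S (S.centroid ℝ id) := by
  refine Finset.sum_congr rfl fun T hT => ?_
  obtain ⟨c, hc⟩ := hy.1 T S (𝒯.mem_powersetCard_of_adjacent hS hT)
  rw [hc x hx, hc _ (𝒯.centroid_mem_hull_of_mem_sides hd hS)]

theorem sideIntegral_mul_normalJump (hd : 1 ≤ d) {y : 𝒯.L1Vec} (hy : y ∈ 𝒯.RT)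
    {S : Finset (Pt d)} (hS : S ∈ 𝒯.sides) (c : ℝ) :
    sideIntegral S (fun x => c * 𝒯.normalJump y S x)
      = (surface d).real (hull S) * (c * 𝒯.normalJump y S (S.centroid ℝ id)) := by
  rw [← sideIntegral_const, sideIntegral, sideIntegral]
  exact setIntegral_congr_fun (isCompact_hull S).measurableSet fun x hx => by
    simp only [𝒯.normalJump_eq_centroid hd hy hS hx]

/-- Element-wise integration by parts, the boundary terms being collected side by side. -/
theorem green_sides (hd : 1 ≤ d) {y : 𝒯.L1Vec} (hy : y ∈ 𝒯.RT) (v : 𝒯.L1) :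
    𝒯.innerL0Vec (𝒯.grad v) (𝒯.projVec y) + 𝒯.innerL0 (𝒯.proj v) (𝒯.div y)
      = ∑ S ∈ 𝒯.sides, (surface d).real (hull S) * ∑ T ∈ 𝒯.adjacent S,
          ⟪y T (S.centroid ℝ id), outerNormal T.1 S⟫ * v T (S.centroid ℝ id) := by
  simp only [Finset.mul_sum]
  rw [innerL0Vec_eq, innerL0_eq, ← Finset.sum_add_distrib,
    ← Finset.sum_comm' (s := Finset.univ) (t := fun T : 𝒯.elems => T.1.powersetCard d)]
  · refine Finset.sum_congr rfl fun T _ => ?_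
    rw [proj_eq, projVec_eq, ← mul_add]
    refine (green_element hd (𝒯.card_elem T T.2) (𝒯.affineIndependent T T.2) (v T)
      (hy.1 T)).trans ?_
    simp only [mul_assoc]
  · intro T S
    simp only [Finset.mem_univ, true_and]
    constructor
    · exact fun h => ⟨𝒯.mem_adjacent.2 (Finset.mem_powersetCard.1 h).1, 𝒯.mem_sides.2 ⟨T, T.2, h⟩⟩
    · exact fun h => 𝒯.mem_powersetCard_of_adjacent h.2 h.1

theorem adjacent_eq_singleton (hd : 1 ≤ d) {S : Finset (Pt d)} (hS : S ∈ 𝒯.boundarySides) :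
    ∃ T, 𝒯.adjacent S = {T} := by
  have hSs := 𝒯.boundarySides_subset_sides hS
  obtain ⟨T, hT⟩ := 𝒯.adjacent_nonempty hSs
  exact ⟨T, Finset.eq_singleton_iff_unique_mem.2 ⟨hT, fun T' hT' =>
    𝒯.eq_of_mem_adjacent hSs (𝒯.notMem_interiorSides_of_mem_boundarySides hd hS) hT' hT⟩⟩

/-- Discrete integration by parts for Crouzeix--Raviart functions and Raviart--Thomas fields. -/
theorem green_CR (hd : 1 ≤ d) {y : 𝒯.L1Vec} (hy : y ∈ 𝒯.RT) {v : 𝒯.L1} (hv : v ∈ 𝒯.CR) :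
    𝒯.innerL0Vec (𝒯.grad v) (𝒯.projVec y) + 𝒯.innerL0 (𝒯.proj v) (𝒯.div y)
      = ∑ S ∈ 𝒯.boundarySides, (surface d).real (hull S)
          * (𝒯.normalJump y S (S.centroid ℝ id) * 𝒯.traceMean v S) := by
  classical
  rw [𝒯.green_sides hd hy v]
  symm
  refine Finset.sum_subset_zero_on_sdiff (fun S hS => 𝒯.boundarySides_subset_sides hS) ?_ ?_
  · intro S hS
    obtain ⟨hS, hSb⟩ := Finset.mem_sdiff.1 hS
    have hSi : S ∈ 𝒯.interiorSides := by
      by_contra h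
      exact hSb (𝒯.mem_boundarySides_of_notMem_interiorSides hd hS h)
    obtain ⟨T₀, hT₀⟩ := 𝒯.adjacent_nonempty hS
    -- On an interior side v has one common barycentre value, which factors out and leaves the
    -- vanishing normal jump of y.
    rw [Finset.sum_congr rfl fun T hT => by rw [(𝒯.mem_CR_iff hd).1 hv S hSi T hT T₀ hT₀],
      ← Finset.sum_mul]
    have := hy.2 S hSi _ (𝒯.centroid_mem_hull_of_mem_sides hd hS)
    rw [normalJump] at this
    rw [this, zero_mul, mul_zero]
  · intro S hS
    obtain ⟨T, hT⟩ := 𝒯.adjacent_eq_singleton hd hS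
    rw [𝒯.traceMean_eq hd (𝒯.boundarySides_subset_sides hS), normalJump, hT]
    simp

open scoped Classical in
-- Side fields are scaled independently on each element. The result is a test field in the
-- Raviart--Thomas space once the values around an interior side S cancel.
theorem exists_L1Vec_normal (hd : 1 ≤ d) {S : Finset (Pt d)} (a : 𝒯.elems → ℝ) :
    ∃ y : 𝒯.L1Vec, ∀ T : 𝒯.elems, ∀ S' ∈ T.1.powersetCard d, ∀ x ∈ hull S',
      ⟪y T x, outerNormal T.1 S'⟫ = if S' = S then a T else 0 := by
  have h : ∀ T : 𝒯.elems, ∃ y : Pt d →ᵃ[ℝ] Pt d, ∀ S' ∈ T.1.powersetCard d, ∀ x ∈ hull S',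
      ⟪y x, outerNormal T.1 S'⟫ = if S' = S then a T else 0 := by
    intro T
    by_cases hS : S ∈ T.1.powersetCard d
    · obtain ⟨y, hy1, hy2⟩ := exists_sideField hd (𝒯.card_elem T T.2) (𝒯.affineIndependent T T.2) hS
      refine ⟨a T • y, fun S' hS' x hx => ?_⟩
      have : (a T • y) x = a T • y x := rfl
      rw [this, inner_smul_left]
      split_ifs with h
      · subst h
        rw [hy1 x hx]; simp
      · rw [hy2 S' hS' h x hx, mul_zero]
    · refine ⟨0, fun S' hS' x hx => ?_⟩
      rw [if_neg fun h : S' = S => hS (h ▸ hS')]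
      simp
  choose y hy using h
  exact ⟨y, hy⟩

open scoped Classical in
theorem normalJump_of_normal {S : Finset (Pt d)} {a : 𝒯.elems → ℝ} {y : 𝒯.L1Vec}
    (hy : ∀ T : 𝒯.elems, ∀ S' ∈ T.1.powersetCard d, ∀ x ∈ hull S',
      ⟪y T x, outerNormal T.1 S'⟫ = if S' = S then a T else 0)
    {S' : Finset (Pt d)} (hS' : S' ∈ 𝒯.sides) {x : Pt d} (hx : x ∈ hull S') :
    𝒯.normalJump y S' x = if S' = S then ∑ T ∈ 𝒯.adjacent S, a T else 0 := by
  rw [normalJump, Finset.sum_congr rfl fun T hT =>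
    hy T S' (𝒯.mem_powersetCard_of_adjacent hS' hT) x hx]
  split_ifs with h
  · rw [h]
  · simp

open scoped Classical in
theorem sidesIn_subset_boundarySides {Γ : Set (Pt d)} {S : Finset (Pt d)} (hS : S ∈ 𝒯.sidesIn Γ) :
    S ∈ 𝒯.boundarySides := (Finset.mem_filter.1 hS).1

theorem sidesIn_subset_sides {Γ : Set (Pt d)} {S : Finset (Pt d)} (hS : S ∈ 𝒯.sidesIn Γ) :
    S ∈ 𝒯.sides := 𝒯.boundarySides_subset_sides (𝒯.sidesIn_subset_boundarySides hS)

theorem disjoint_sidesIn (hd : 1 ≤ d) {A B : Set (Pt d)} (h : Disjoint A B) :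
    Disjoint (𝒯.sidesIn A) (𝒯.sidesIn B) := by
  classical
  rw [Finset.disjoint_left]
  intro S hA hB
  have hne : (hull S).Nonempty :=
    ⟨_, 𝒯.centroid_mem_hull_of_mem_sides hd (𝒯.sidesIn_subset_sides hA)⟩
  obtain ⟨x, hx⟩ := hne.intrinsicInterior (convex_hull S)
  exact Set.disjoint_left.1 h ((Finset.mem_filter.1 hA).2 hx) ((Finset.mem_filter.1 hB).2 hx)

namespace BoundaryParts

variable {𝒯} (Γ : 𝒯.BoundaryParts)

theorem sum_boundarySides (hd : 1 ≤ d) (F : Finset (Pt d) → ℝ) :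
    ∑ S ∈ 𝒯.boundarySides, F S = ∑ S : 𝒯.sidesIn Γ.ΓI, F S + ∑ S : 𝒯.sidesIn Γ.ΓD, F S
      + ∑ S : 𝒯.sidesIn Γ.ΓN, F S := by
  classical
  have h : 𝒯.boundarySides = (𝒯.sidesIn Γ.ΓI ∪ 𝒯.sidesIn Γ.ΓD) ∪ 𝒯.sidesIn Γ.ΓN := by
    ext S
    simp only [Finset.mem_union]
    constructor
    · intro hS
      have := Γ.resolved S hS
      tauto
    · rintro ((hS | hS) | hS) <;> exact 𝒯.sidesIn_subset_boundarySides hS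
  rw [h, Finset.sum_union, Finset.sum_union (𝒯.disjoint_sidesIn hd Γ.disjoint_ID)]
  · simp only [Finset.sum_coe_sort]
  · exact Finset.disjoint_union_left.2
      ⟨𝒯.disjoint_sidesIn hd Γ.disjoint_IN, 𝒯.disjoint_sidesIn hd Γ.disjoint_DN⟩

end BoundaryParts

end Triangulation
end OptimalInsulation

namespace OptimalInsulation
-- The reconstructed function, its traces and its minimality
namespace Triangulation

variable {d : ℕ} (𝒯 : Triangulation d)

/-- The inverse generalised Marini formula: the element-wise affine function with mean values `c` and
gradients `a`. -/
def marini (a : 𝒯.L0Vec) (c : 𝒯.L0) : 𝒯.L1 := fun T =>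
  (innerSL ℝ (a T)).toLinearMap.toAffineMap
    + AffineMap.const ℝ (Pt d) (c T - ⟪a T, T.1.centroid ℝ id⟫)

theorem marini_apply (a : 𝒯.L0Vec) (c : 𝒯.L0) (T : 𝒯.elems) (x : Pt d) :
    𝒯.marini a c T x = c T + ⟪a T, x - T.1.centroid ℝ id⟫ := by
  have : 𝒯.marini a c T x = ⟪a T, x⟫ + (c T - ⟪a T, T.1.centroid ℝ id⟫) := rfl
  rw [this, inner_sub_right]
  ring

theorem grad_marini (a : 𝒯.L0Vec) (c : 𝒯.L0) : 𝒯.grad (𝒯.marini a c) = a := by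
  funext T
  refine ext_inner_right ℝ fun x => ?_
  rw [grad, inner_affineGrad]
  simp [marini]

theorem proj_marini (a : 𝒯.L0Vec) (c : 𝒯.L0) : 𝒯.proj (𝒯.marini a c) = c := by
  funext T
  rw [proj_eq, marini_apply, sub_self, inner_zero_right, add_zero]

variable {𝒯} {Γ : 𝒯.BoundaryParts} {m : ℝ} {f : 𝒯.L0} {g : 𝒯.L0Sides Γ.ΓN}
  {uD : 𝒯.L0Sides Γ.ΓD} {z : 𝒯.L1Vec} {ubar : 𝒯.L0} {μ : ℝ} {lamP lamM : 𝒯.L0Sides Γ.ΓI}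

namespace BoundaryParts.IsKKT

open scoped Classical in
/-- The stationarity condition, tested with a field whose normal component is supported on a
single side. -/
theorem stationary_side (hK : Γ.IsKKT m f g uD z ubar μ lamP lamM) (hd : 1 ≤ d)
    {S : Finset (Pt d)} (hS : S ∈ 𝒯.sides) (a : 𝒯.elems → ℝ)
    (hi : S ∈ 𝒯.interiorSides → ∑ T ∈ 𝒯.adjacent S, a T = 0)
    (hN : S ∈ 𝒯.sidesIn Γ.ΓN → ∑ T ∈ 𝒯.adjacent S, a T = 0) :
    ∑ T ∈ 𝒯.adjacent S, a T * 𝒯.marini (𝒯.projVec z) ubar T (S.centroid ℝ id)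
      + ∑ S' : 𝒯.sidesIn Γ.ΓI,
          (if S'.1 = S then (lamP S' - lamM S') * ∑ T ∈ 𝒯.adjacent S, a T else 0)
      = ∑ S' : 𝒯.sidesIn Γ.ΓD, (if S'.1 = S then uD S' * ∑ T ∈ 𝒯.adjacent S, a T else 0) := by
  obtain ⟨y, hy⟩ := 𝒯.exists_L1Vec_normal hd (S := S) a
  have hj := fun (S' : Finset (Pt d)) (hS' : S' ∈ 𝒯.sides) (x : Pt d) (hx : x ∈ hull S') =>
    𝒯.normalJump_of_normal hy hS' hx
  have hyRT : y ∈ 𝒯.RT := by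
    refine ⟨fun T S' hS' => ⟨_, hy T S' hS'⟩, fun S' hS' x hx => ?_⟩
    rw [hj S' (𝒯.interiorSides_subset_sides hS') x hx]
    split_ifs with h
    · exact hi (h ▸ hS')
    · rfl
  have hyN : y ∈ Γ.RTN := by
    refine ⟨hyRT, fun S' hS' x hx => ?_⟩
    rw [hj S' (𝒯.sidesIn_subset_sides hS') x hx]
    split_ifs with h
    · exact hN (h ▸ hS')
    · rfl
  have hst := hK.stationary y hyN
  -- Green's formula without any continuity of the reconstruction turns the first two stationarity
  -- terms into side terms; only S survives, and its positive area cancels.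
  have hgreen := 𝒯.green_sides hd hyRT (𝒯.marini (𝒯.projVec z) ubar)
  rw [grad_marini, proj_marini] at hgreen
  rw [hgreen, Finset.sum_eq_single_of_mem S hS] at hst
  · have hσ := (𝒯.area_pos hd hS).ne'
    have hterm : ∀ (A : Set (Pt d)) (c : 𝒯.L0Sides A), ∑ S' : 𝒯.sidesIn A,
        sideIntegral S'.1 (fun x => c S' * 𝒯.normalJump y S' x)
        = (surface d).real (hull S) * ∑ S' : 𝒯.sidesIn A,
          (if S'.1 = S then c S' * ∑ T ∈ 𝒯.adjacent S, a T else 0) := by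
      intro A c
      rw [Finset.mul_sum]
      refine Finset.sum_congr rfl fun S' _ => ?_
      have hS' := 𝒯.sidesIn_subset_sides S'.2
      rw [𝒯.sideIntegral_mul_normalJump hd hyRT hS',
        hj S' hS' _ (𝒯.centroid_mem_hull_of_mem_sides hd hS')]
      split_ifs with h
      · rw [h]
      · simp
    have hadj : ∑ T ∈ 𝒯.adjacent S, ⟪y T (S.centroid ℝ id), outerNormal T.1 S⟫
          * 𝒯.marini (𝒯.projVec z) ubar T (S.centroid ℝ id)
        = ∑ T ∈ 𝒯.adjacent S, a T * 𝒯.marini (𝒯.projVec z) ubar T (S.centroid ℝ id) := by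
      refine Finset.sum_congr rfl fun T hT => ?_
      rw [hy T S (𝒯.mem_powersetCard_of_adjacent hS hT) _
        (𝒯.centroid_mem_hull_of_mem_sides hd hS), if_pos rfl]
    rw [hterm Γ.ΓI (fun S' => lamP S' - lamM S'), hterm Γ.ΓD uD, hadj, ← mul_add] at hst
    exact mul_left_cancel₀ hσ hst
  · intro S' hS' hne
    rw [Finset.sum_eq_zero, mul_zero]
    intro T hT
    rw [hy T S' (𝒯.mem_powersetCard_of_adjacent hS' hT) _
      (𝒯.centroid_mem_hull_of_mem_sides hd hS'), if_neg hne, zero_mul]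

theorem marini_mem_CR (hK : Γ.IsKKT m f g uD z ubar μ lamP lamM) (hd : 1 ≤ d) :
    𝒯.marini (𝒯.projVec z) ubar ∈ 𝒯.CR := by
  classical
  refine (𝒯.mem_CR_iff hd).2 fun S hS T hT T' hT' => ?_
  -- The test values are +1 on T and -1 on T'; their zero sum makes the field admissible and removes
  -- all multiplier and Dirichlet terms.
  have hsum : ∑ R ∈ 𝒯.adjacent S, ((if R = T then (1 : ℝ) else 0) - if R = T' then 1 else 0) = 0 := by
    rw [Finset.sum_sub_distrib, Finset.sum_ite_eq', Finset.sum_ite_eq', if_pos hT, if_pos hT',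
      sub_self]
  have h := hK.stationary_side hd (𝒯.interiorSides_subset_sides hS) _ (fun _ => hsum)
    (fun _ => hsum)
  rw [hsum] at h
  simpa [sub_mul, hT, hT', sub_eq_zero] using h

open scoped Classical in
-- A boundary side has a single element, so off the Neumann part the test field with normal
-- component 1 there is admissible. Each sum has at most one nonzero term and merely selects the
-- boundary part containing S.
theorem traceMean_marini (hK : Γ.IsKKT m f g uD z ubar μ lamP lamM) (hd : 1 ≤ d)
    {S : Finset (Pt d)} (hS : S ∈ 𝒯.boundarySides) (hN : S ∉ 𝒯.sidesIn Γ.ΓN) :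
    𝒯.traceMean (𝒯.marini (𝒯.projVec z) ubar) S
      + ∑ S' : 𝒯.sidesIn Γ.ΓI, (if S'.1 = S then lamP S' - lamM S' else 0)
      = ∑ S' : 𝒯.sidesIn Γ.ΓD, (if S'.1 = S then uD S' else 0) := by
  have hSs := 𝒯.boundarySides_subset_sides hS
  obtain ⟨T, hT⟩ := 𝒯.adjacent_eq_singleton hd hS
  have h := hK.stationary_side hd hSs (fun _ => 1)
    (fun h => absurd h (𝒯.notMem_interiorSides_of_mem_boundarySides hd hS)) (fun h => absurd h hN)
  rw [𝒯.traceMean_eq hd hSs]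
  simpa [hT] using h

theorem traceMean_dirichlet (hK : Γ.IsKKT m f g uD z ubar μ lamP lamM) (hd : 1 ≤ d)
    (S : 𝒯.sidesIn Γ.ΓD) : 𝒯.traceMean (𝒯.marini (𝒯.projVec z) ubar) S = uD S := by
  classical
  have h := hK.traceMean_marini hd (𝒯.sidesIn_subset_boundarySides S.2)
    (Finset.disjoint_left.1 (𝒯.disjoint_sidesIn hd Γ.disjoint_DN) S.2)
  rw [Finset.sum_eq_zero (s := (Finset.univ : Finset (𝒯.sidesIn Γ.ΓI))), add_zero] at h
  · simpa [Subtype.coe_inj] using h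
  · intro S' _
    rw [if_neg]
    intro h'
    exact Finset.disjoint_left.1 (𝒯.disjoint_sidesIn hd Γ.disjoint_ID) S'.2 (h' ▸ S.2)

theorem traceMean_insulated (hK : Γ.IsKKT m f g uD z ubar μ lamP lamM) (hd : 1 ≤ d)
    (S : 𝒯.sidesIn Γ.ΓI) :
    𝒯.traceMean (𝒯.marini (𝒯.projVec z) ubar) S = lamM S - lamP S := by
  classical
  have h := hK.traceMean_marini hd (𝒯.sidesIn_subset_boundarySides S.2)
    (Finset.disjoint_left.1 (𝒯.disjoint_sidesIn hd Γ.disjoint_IN) S.2)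
  rw [Finset.sum_eq_zero (s := (Finset.univ : Finset (𝒯.sidesIn Γ.ΓD)))] at h
  · have h2 : 𝒯.traceMean (𝒯.marini (𝒯.projVec z) ubar) S + (lamP S - lamM S) = 0 := by
      simpa [Subtype.coe_inj] using h
    linarith
  · intro S' _
    rw [if_neg]
    intro h'
    exact Finset.disjoint_left.1 (𝒯.disjoint_sidesIn hd Γ.disjoint_ID) S.2 (h' ▸ S'.2)

/-- Discrete integration by parts against the dual solution. -/
theorem green_dual (hK : Γ.IsKKT m f g uD z ubar μ lamP lamM) (hd : 1 ≤ d) {v : 𝒯.L1}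
    (hv : v ∈ 𝒯.CR) (hvD : ∀ S : 𝒯.sidesIn Γ.ΓD, 𝒯.traceMean v S = uD S) :
    𝒯.innerL0Vec (𝒯.grad v) (𝒯.projVec z) - 𝒯.innerL0 f (𝒯.proj v)
        - ∑ S : 𝒯.sidesIn Γ.ΓN, sideIntegral S.1 (fun _ => g S * 𝒯.traceMean v S)
      = ∑ S : 𝒯.sidesIn Γ.ΓI, (surface d).real (hull S.1)
          * (𝒯.normalJump z S (S.1.centroid ℝ id) * 𝒯.traceMean v S)
        + ∑ S : 𝒯.sidesIn Γ.ΓD, (surface d).real (hull S.1)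
          * (𝒯.normalJump z S (S.1.centroid ℝ id) * uD S) := by
  have h := 𝒯.green_CR hd hK.mem_RT hv
  rw [Γ.sum_boundarySides hd] at h
  have hdiv : 𝒯.innerL0 (𝒯.proj v) (𝒯.div z) = -𝒯.innerL0 f (𝒯.proj v) := by
    rw [← hK.divergence, innerL0_eq, innerL0_eq]
    simp only [mul_comm]
  have hNeu : ∑ S : 𝒯.sidesIn Γ.ΓN, (surface d).real (hull S.1)
        * (𝒯.normalJump z S (S.1.centroid ℝ id) * 𝒯.traceMean v S)
      = ∑ S : 𝒯.sidesIn Γ.ΓN, sideIntegral S.1 (fun _ => g S * 𝒯.traceMean v S) := by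
    refine Finset.sum_congr rfl fun S _ => ?_
    rw [sideIntegral_const, hK.neumann S _
      (𝒯.centroid_mem_hull_of_mem_sides hd (𝒯.sidesIn_subset_sides S.2))]
  simp only [hvD] at h
  rw [hdiv, hNeu] at h
  linarith

/-- The dual variable `μ` is the mean absolute trace of the primal solution. -/
theorem sum_abs_traceMean (hK : Γ.IsKKT m f g uD z ubar μ lamP lamM) (hd : 1 ≤ d) :
    ∑ S : 𝒯.sidesIn Γ.ΓI, (surface d).real (hull S.1) * |lamM S - lamP S| = m * μ := by
  have hμ : m * μ = ∑ S : 𝒯.sidesIn Γ.ΓI, (surface d).real (hull S.1) * (-(lamP S + lamM S)) := by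
    have h := hK.multiplier 1
    simp only [mul_one, sideIntegral_const] at h
    simp only [mul_neg, Finset.sum_neg_distrib]
    linarith
  have hpos : ∀ S : 𝒯.sidesIn Γ.ΓI, 0 < (surface d).real (hull S.1) := fun S =>
    𝒯.area_pos hd (𝒯.sidesIn_subset_sides S.2)
  have hc : ∀ S : 𝒯.sidesIn Γ.ΓI, S.1.centroid ℝ id ∈ hull S.1 := fun S =>
    𝒯.centroid_mem_hull_of_mem_sides hd (𝒯.sidesIn_subset_sides S.2)
  rw [hμ]
  -- If both multipliers were nonzero, complementarity would force μ + z·n = μ - z·n = 0, so μ = 0;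
  -- the multiplier equation would then make a sum of nonpositive multipliers vanish, hence each of
  -- them.
  have hprod : ∀ S : 𝒯.sidesIn Γ.ΓI, lamP S = 0 ∨ lamM S = 0 := by
    intro S
    by_contra! hne
    have h1 := (mul_eq_zero.1 (hK.complementary_pos S _ (hc S))).resolve_left hne.1
    have h2 := (mul_eq_zero.1 (hK.complementary_neg S _ (hc S))).resolve_left hne.2
    have hμ0 : μ = 0 := by linarith
    rw [hμ0, mul_zero] at hμ
    have h3 := (Finset.sum_eq_zero_iff_of_nonneg fun S' _ => mul_nonneg (hpos S').le
      (by linarith [hK.sign_pos S', hK.sign_neg S'])).1 hμ.symm S (Finset.mem_univ _)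
    have h4 := (mul_eq_zero.1 h3).resolve_left (hpos S).ne'
    exact hne.1 (by linarith [hK.sign_pos S, hK.sign_neg S])
  refine Finset.sum_congr rfl fun S _ => ?_
  congr 1
  rcases hprod S with h | h
  · rw [h, sub_zero, zero_add, abs_of_nonpos (hK.sign_neg S)]
  · rw [h, zero_sub, add_zero, abs_of_nonneg (by linarith [hK.sign_pos S])]

/-- Adding the complementarity conditions gives z·n (λ⁻ - λ⁺) = μ (λ⁺ + λ⁻); the multiplier equation
tested with η = μ evaluates the sum. -/
theorem sum_flux_traceMean (hK : Γ.IsKKT m f g uD z ubar μ lamP lamM) (hd : 1 ≤ d) :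
    ∑ S : 𝒯.sidesIn Γ.ΓI, (surface d).real (hull S.1)
      * (𝒯.normalJump z S (S.1.centroid ℝ id) * (lamM S - lamP S)) = -(m * μ * μ) := by
  have h := hK.multiplier μ
  simp only [sideIntegral_const] at h
  rw [← eq_neg_iff_add_eq_zero] at h
  rw [h, neg_neg]
  refine Finset.sum_congr rfl fun S _ => ?_
  have hc := 𝒯.centroid_mem_hull_of_mem_sides hd (𝒯.sidesIn_subset_sides S.2)
  congr 1
  linear_combination -hK.complementary_pos S _ hc - hK.complementary_neg S _ hc

/-- Feasibility says |z·n| ≤ μ on Γ_I. This bounds the flux term of any competitor, with equality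
for the reconstruction. -/
theorem neg_le_sum_flux (hK : Γ.IsKKT m f g uD z ubar μ lamP lamM) (hd : 1 ≤ d)
    (V : Finset (Pt d) → ℝ) :
    -(μ * ∑ S : 𝒯.sidesIn Γ.ΓI, (surface d).real (hull S.1) * |V S|)
      ≤ ∑ S : 𝒯.sidesIn Γ.ΓI, (surface d).real (hull S.1)
        * (𝒯.normalJump z S (S.1.centroid ℝ id) * V S) := by
  rw [Finset.mul_sum, ← Finset.sum_neg_distrib]
  refine Finset.sum_le_sum fun S _ => ?_
  have hS := 𝒯.sidesIn_subset_sides S.2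
  have hc := 𝒯.centroid_mem_hull_of_mem_sides hd hS
  have h1 : |𝒯.normalJump z S (S.1.centroid ℝ id)| ≤ μ :=
    abs_le.2 ⟨by linarith [hK.feasible_pos S _ hc], by linarith [hK.feasible_neg S _ hc]⟩
  have h2 := neg_abs_le (𝒯.normalJump z S (S.1.centroid ℝ id) * V S)
  rw [abs_mul] at h2
  have h3 := mul_le_mul_of_nonneg_right h1 (abs_nonneg (V S))
  calc -(μ * ((surface d).real (hull S.1) * |V S|))
      = (surface d).real (hull S.1) * -(μ * |V S|) := by ring
    _ ≤ _ := mul_le_mul_of_nonneg_left (by linarith) (𝒯.area_pos hd hS).le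

theorem isPrimalSolution_marini (hK : Γ.IsKKT m f g uD z ubar μ lamP lamM) (hd : 1 ≤ d)
    (hm : 0 < m) : Γ.IsPrimalSolution m f g uD (𝒯.marini (𝒯.projVec z) ubar) := by
  have huD := hK.traceMean_dirichlet hd
  have huCR := hK.marini_mem_CR hd
  have huI := hK.traceMean_insulated hd
  set u := 𝒯.marini (𝒯.projVec z) ubar with hu
  have hgu : 𝒯.grad u = 𝒯.projVec z := 𝒯.grad_marini _ _
  refine ⟨huCR, ?_, fun v hv => ?_⟩
  · rw [primalEnergy, if_pos huD]
    exact EReal.coe_ne_top _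
  by_cases hvD : ∀ S : 𝒯.sidesIn Γ.ΓD, 𝒯.traceMean v S = uD S
  swap
  · rw [primalEnergy, primalEnergy, if_neg hvD]
    exact le_top
  rw [primalEnergy, primalEnergy, if_pos huD, if_pos hvD, EReal.coe_le_coe_iff]
  have hgv := hK.green_dual hd hv hvD
  have hgu' := hK.green_dual hd huCR huD
  have hflux := hK.sum_flux_traceMean hd
  have habs := hK.sum_abs_traceMean hd
  have hle := hK.neg_le_sum_flux hd (𝒯.traceMean v)
  simp only [← huI] at hflux habs
  -- The element-wise square |∇_h v - Π_h z|² is nonnegative; it vanishes for v = u.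
  have hsq : 2 * 𝒯.innerL0Vec (𝒯.grad v) (𝒯.projVec z) ≤ 𝒯.innerL0Vec (𝒯.grad v) (𝒯.grad v)
      + 𝒯.innerL0Vec (𝒯.projVec z) (𝒯.projVec z) := by
    rw [innerL0Vec_eq, innerL0Vec_eq, innerL0Vec_eq, Finset.mul_sum, ← Finset.sum_add_distrib]
    refine Finset.sum_le_sum fun T _ => ?_
    have h1 : 0 ≤ volume.real (hull T.1) := measureReal_nonneg
    have h2 : 0 ≤ ⟪𝒯.grad v T - 𝒯.projVec z T, 𝒯.grad v T - 𝒯.projVec z T⟫ :=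
      real_inner_self_nonneg
    rw [real_inner_sub_sub_self] at h2
    nlinarith [mul_nonneg h1 h2]
  have habsI : ∀ w : 𝒯.L1, ∑ S : 𝒯.sidesIn Γ.ΓI, sideIntegral S.1 (fun _ => |𝒯.traceMean w S|)
      = ∑ S : 𝒯.sidesIn Γ.ΓI, (surface d).real (hull S.1) * |𝒯.traceMean w S| := fun w =>
    Finset.sum_congr rfl fun S _ => sideIntegral_const _ _
  rw [hgu] at hgu' ⊢
  rw [habsI, habsI, habs]
  rw [hflux] at hgu'
  set A := ∑ S : 𝒯.sidesIn Γ.ΓI, (surface d).real (hull S.1) * |𝒯.traceMean v S|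
  -- The parabola A²/(2m) - μA is minimal at A = mμ, the boundary norm of u.
  have hyoung : 1 / (2 * m) * (m * μ) ^ 2 - m * μ * μ ≤ 1 / (2 * m) * A ^ 2 - μ * A := by
    have h : 0 ≤ 1 / (2 * m) * (A - m * μ) ^ 2 := by positivity
    have h2 : 1 / (2 * m) * (A - m * μ) ^ 2
        = (1 / (2 * m) * A ^ 2 - μ * A) - (1 / (2 * m) * (m * μ) ^ 2 - m * μ * μ) := by
      field_simp
      ring
    linarith
  linarith

end BoundaryParts.IsKKT

end Triangulation
end OptimalInsulation

end

theorem lemma7p1 (d : ℕ) (hd : 1 ≤ d)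
    (𝒯 : OptimalInsulation.Triangulation d) (Γ : 𝒯.BoundaryParts)
    (m : ℝ) (hm : 0 < m) (f : 𝒯.L0) (g : 𝒯.L0Sides Γ.ΓN) (uD : 𝒯.L0Sides Γ.ΓD)
    (z : 𝒯.L1Vec) (ubar : 𝒯.L0) (μ : ℝ) (lamP lamM : 𝒯.L0Sides Γ.ΓI)
    (hKKT : Γ.IsKKT m f g uD z ubar μ lamP lamM) :
    ∃ u : 𝒯.L1,
      (∀ T : 𝒯.elems, ∀ x ∈ OptimalInsulation.hull T.1,
        u T x = ubar T
          + inner ℝ (𝒯.projVec z T) (x - OptimalInsulation.elemMean T.1 (fun p => p))) ∧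
      u ∈ 𝒯.CR ∧ Γ.IsPrimalSolution m f g uD u := by
  refine ⟨𝒯.marini (𝒯.projVec z) ubar, fun T x _ => ?_, hKKT.marini_mem_CR hd,
    hKKT.isPrimalSolution_marini hd hm⟩
  have h : OptimalInsulation.elemMean T.1 (fun p => p) = T.1.centroid ℝ id :=
    OptimalInsulation.elemMean_affineMap (𝒯.card_elem T T.2) (𝒯.affineIndependent T T.2)
      (AffineMap.id ℝ (OptimalInsulation.Pt d))
  rw [𝒯.marini_apply, h]
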